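/- Let $f:\mathbb R\to\mathbb R$ be a $C^1$ flux, $\lambda>0$, and let $I\subseteq\mathbb R$ be an interval on which the subcharacteristic condition $-\lambda\le f'(u)\le\lambda$ holds ($I=\mathbb R$ is allowed). For $\Delta x,\Delta t>0$ let the cells be $[j\Delta x,(j+1)\Delta x]$, $j\in\mathbb Z$; the coupling node $x=0$ separates the cells $-1$ and $0$. For a grid function $u^n=(u^n_j)_{j\in\mathbb Z}$ set $w^{n\mp}_j=\tfrac12 f(u^n_j)\mp\tfrac{\lambda}{2}u^n_j$ and let $$s^{n\mp}_j=\operatorname{minmod}\Big(2\tfrac{w^{n\mp}_j-w^{n\mp}_{j-1}}{\Delta x},\ \tfrac{w^{n\mp}_{j+1}-w^{n\mp}_{j-1}}{2\Delta x},\ 2\tfrac{w^{n\mp}_{j+1}-w^{n\mp}_j}{\Delta x}\Big)\quad (j\ne -1,0),\qquad s^{n\mp}_{-1}=s^{n\mp}_0=0,$$ where $\operatorname{minmod}$ is the largest argument if all arguments are negative, the smallest if all are positive, and $0$ otherwise. With the coupling data $$u^n_R=u^n_L=\tfrac{u^n_{-1}+u^n_0}{2}+\tfrac{f(u^n_{-1})-f(u^n_0)}{2\lambda},\qquad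 v^n_R=v^n_L=\tfrac{f(u^n_{-1})+f(u^n_0)}{2}+\tfrac{\lambda}{2}(u^n_{-1}-u^n_0)$$ consider the second-order limit scheme $$u^{n+1}_j=u^n_j-\tfrac{\Delta t}{2\Delta x}\big(f(u^n_{j+1})-f(u^n_{j-1})\big)+\tfrac{\lambda\Delta t}{2\Delta x}\big(u^n_{j+1}-2u^n_j+u^n_{j-1}\big)+\tfrac{\Delta t}{2}\big(s^{n-}_{j+1}-(s^{n+}_j+s^{n-}_j)+s^{n+}_{j-1}\big),\quad j\ne-1,0,$$ $$u^{n+1}_{-1}=u^n_{-1}-\tfrac{\Delta t}{2\Delta x}\big(v^n_R-f(u^n_{-2})\big)+\tfrac{\lambda\Delta t}{2\Delta x}\big(u^n_R-2u^n_{-1}+u^n_{-2}\big)-\tfrac{\Delta t}{2}\big(s^{n-}_{-1}-s^{n+}_{-2}\big),$$ $$u^{n+1}_{0}=u^n_{0}-\tfrac{\Delta t}{2\Delta x}\big(f(u^n_1)-v^n_L\big)+\tfrac{\lambda\Delta t}{2\Delta x}\big(u^n_1-2u^n_0+u^n_L\big)+\tfrac{\Delta t}{2}\big(s^{n-}_{1}-s^{n+}_{0}\big).$$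 Then: 1. (Consistency.) The scheme has the conservative form $u^{n+1}_j=u^n_j-\frac{\Delta t}{\Delta x}(F^n_{j+1/2}-F^n_{j-1/2})$, $j\in\mathbb Z$, with $$F^n_{j-1/2}=\tfrac12\big(f(u^n_{j-1})+f(u^n_j)\big)-\tfrac\lambda2\big(u^n_j-u^n_{j-1}\big)-\tfrac{\Delta x}{2}\big(s^{n-}_j-s^{n+}_{j-1}\big),$$ and this flux is consistent with $f$: $F^n_{j-1/2}=f(c)$ if $u^n\equiv c$, and there is a constant $L$, independent of $\Delta x$, $j$, $u^n$ and $c$, with $|F^n_{j-1/2}-f(c)|\le L\max_{j-2\le i\le j+1}|u^n_i-c|$ for $u^n$ with values in $I$ and $c\in I$. 2. (Total variation diminishing.) If $\lambda\Delta t\le\Delta x/2$ and $u^0$ has values in $I$, then $\sum_j|u^{n+1}_{j+1}-u^{n+1}_j|\le\sum_j|u^n_{j+1}-u^n_j|$ for all $n\in\mathbb N_0$ (in $[0,\infty]$). 3. (Convergence.) Let $u_0:\mathbb R\to I$ have bounded variation, let the scheme start from the cell averages of $u_0$, and let $U_{\Delta x,\Delta t}(x,t)=u^n_j$ for $x\in[j\Delta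 x,(j+1)\Delta x)$, $t\in[n\Delta t,(n+1)\Delta t)$. Let $\mathcal W$ be the set of bounded weak solutions on $\mathbb R\times(0,\infty)$ of $\partial_tu+\partial_xf(u)=0$ with initial data $u_0$, i.e. of $u\in L^\infty(\mathbb R\times(0,\infty))$ with $\int_0^\infty\!\int_{\mathbb R}(u\,\partial_t\varphi+f(u)\,\partial_x\varphi)\,dx\,dt+\int_{\mathbb R}u_0\,\varphi(\cdot,0)\,dx=0$ for all $\varphi\in C^1_c(\mathbb R^2)$. Under the condition $\lambda\Delta t\le\Delta x/2$, as $\Delta x,\Delta t\to0$, the scheme converges to weak solutions: for every $T>0$ the distance in $L^1(\mathbb R\times(0,T))$ of $U_{\Delta x,\Delta t}$ to $\mathcal W$ tends to $0$; along every sequence of grids with $\Delta x_k,\Delta t_k\to0$ there are a subsequence and one $w\in\mathcal W$ such that $U_{\Delta x_k,\Delta t_k}\to w$ in $L^1(\mathbb R\times(0,T))$ for every $T>0$ along this subsequence; and if the weak solution is unique up to null sets, the whole sequence converges to it. -/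

import Mathlib

open Set Filter Topology MeasureTheory
open scoped ENNReal

noncomputable section

namespace CentralScheme

/-- The minmod operator of three arguments. -/
def minmod (a b c : ℝ) : ℝ :=
  if a < 0 ∧ b < 0 ∧ c < 0 then max a (max b c)
  else if 0 < a ∧ 0 < b ∧ 0 < c then min a (min b c)
  else 0

/-- The monotonized central-difference limited slope of the grid function `w` in cell `j`. -/
def mcSlope (dx : ℝ) (w : ℤ → ℝ) (j : ℤ) : ℝ :=
  minmod (2 * ((w j - w (j - 1)) / dx)) ((w (j + 1) - w (j - 1)) / (2 * dx))
    (2 * ((w (j + 1) - w j) / dx))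

/-- The coupling data at the node: states on the left side (index `R`, right end of the
incoming edge) and on the right side (index `L`, left end of the outgoing edge). -/
structure CouplingData where
  uR : ℝ
  vR : ℝ
  uL : ℝ
  vL : ℝ

/-- The Riemann solver of the coupled relaxation system with relaxation speeds `lam₁`, `lam₂`,
applied to the traces `(um, vm)` (left of the node) and `(up, vp)` (right of the node). -/
def relaxationRS (lam₁ lam₂ um vm up vp : ℝ) : CouplingData where
  uR := lam₂ / lam₁ * ((lam₁ * um + lam₂ * up + vm - vp) / (lam₁ + lam₂))
  vR := (lam₁ * vm + lam₂ * vp + lam₁ ^ 2 * um - lam₂ ^ 2 * up) / (lam₁ + lam₂)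
  uL := lam₁ / lam₂ * ((lam₁ * um + lam₂ * up + vm - vp) / (lam₁ + lam₂))
  vL := (lam₁ * vm + lam₂ * vp + lam₁ ^ 2 * um - lam₂ ^ 2 * up) / (lam₁ + lam₂)

/-- The datum of the edge that contains cell `j`: cells `j < 0` lie on the incoming edge,
cells `j ≥ 0` on the outgoing edge. -/
def onEdge {β : Type} (a₁ a₂ : β) (j : ℤ) : β := if j < 0 then a₁ else a₂

/-- Characteristic variable `w⁻_j = f(u_j)/2 - λ u_j/2`, with the flux and speed of the edge. -/
def wMinus (f₁ f₂ : ℝ → ℝ) (lam₁ lam₂ : ℝ) (u : ℤ → ℝ) (j : ℤ) : ℝ :=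
  1 / 2 * onEdge f₁ f₂ j (u j) - onEdge lam₁ lam₂ j / 2 * u j

/-- Characteristic variable `w⁺_j = f(u_j)/2 + λ u_j/2`, with the flux and speed of the edge. -/
def wPlus (f₁ f₂ : ℝ → ℝ) (lam₁ lam₂ : ℝ) (u : ℤ → ℝ) (j : ℤ) : ℝ :=
  1 / 2 * onEdge f₁ f₂ j (u j) + onEdge lam₁ lam₂ j / 2 * u j

/-- Slopes `s⁻_j`. They vanish in the two cells next to the node: `s⁻_0 = 0` is forced by the
coupling data, and `s⁻_{-1} = 0` is the choice made in the scheme under consideration. -/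
def slopeMinus (f₁ f₂ : ℝ → ℝ) (lam₁ lam₂ dx : ℝ) (u : ℤ → ℝ) (j : ℤ) : ℝ :=
  if j = -1 ∨ j = 0 then 0 else mcSlope dx (wMinus f₁ f₂ lam₁ lam₂ u) j

/-- Slopes `s⁺_j`. They vanish in the two cells next to the node: `s⁺_{-1} = 0` is forced by the
coupling data, and `s⁺_0 = 0` is the choice made in the scheme under consideration. -/
def slopePlus (f₁ f₂ : ℝ → ℝ) (lam₁ lam₂ dx : ℝ) (u : ℤ → ℝ) (j : ℤ) : ℝ :=
  if j = -1 ∨ j = 0 then 0 else mcSlope dx (wPlus f₁ f₂ lam₁ lam₂ u) j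

/-- One time step `uⁿ ↦ uⁿ⁺¹` of the second-order limit scheme on the 1-to-1 network, with
coupling data at the node obtained from `(u_{-1}, f₁(u_{-1}))` and `(u_0, f₂(u_0))`. -/
def step (f₁ f₂ : ℝ → ℝ) (lam₁ lam₂ dx dt : ℝ) (u : ℤ → ℝ) (j : ℤ) : ℝ :=
  let sm := slopeMinus f₁ f₂ lam₁ lam₂ dx u
  let sp := slopePlus f₁ f₂ lam₁ lam₂ dx u
  let c := relaxationRS lam₁ lam₂ (u (-1)) (f₁ (u (-1))) (u 0) (f₂ (u 0))
  if j = -1 then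
    u (-1) - dt / (2 * dx) * (c.vR - f₁ (u (-2)))
      + lam₁ * dt / (2 * dx) * (c.uR - 2 * u (-1) + u (-2))
      - dt / 2 * (sm (-1) - sp (-2))
  else if j = 0 then
    u 0 - dt / (2 * dx) * (f₂ (u 1) - c.vL)
      + lam₂ * dt / (2 * dx) * (u 1 - 2 * u 0 + c.uL)
      + dt / 2 * (sm 1 - sp 0)
  else
    u j - dt / (2 * dx) * (onEdge f₁ f₂ j (u (j + 1)) - onEdge f₁ f₂ j (u (j - 1)))
      + onEdge lam₁ lam₂ j * dt / (2 * dx) * (u (j + 1) - 2 * u j + u (j - 1))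
      + dt / 2 * (sm (j + 1) - (sp j + sm j) + sp (j - 1))

/-- The numerical flux `F_{j-1/2}` at the left interface of cell `j`. -/
def numFlux (f₁ f₂ : ℝ → ℝ) (lam₁ lam₂ dx : ℝ) (u : ℤ → ℝ) (j : ℤ) : ℝ :=
  let sm := slopeMinus f₁ f₂ lam₁ lam₂ dx u
  let sp := slopePlus f₁ f₂ lam₁ lam₂ dx u
  if j < 0 then
    1 / 2 * (f₁ (u (j - 1)) + f₁ (u j)) - lam₁ / 2 * (u j - u (j - 1))
      - dx / 2 * (sm j - sp (j - 1))
  else if j = 0 then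
    1 / (lam₁ + lam₂) * (lam₁ * f₁ (u (-1)) + lam₂ * f₂ (u 0))
      - 1 / (lam₁ + lam₂) * (lam₂ ^ 2 * u 0 - lam₁ ^ 2 * u (-1))
  else
    1 / 2 * (f₂ (u (j - 1)) + f₂ (u j)) - lam₂ / 2 * (u j - u (j - 1))
      - dx / 2 * (sm j - sp (j - 1))

/-- The grid function `uⁿ` produced by `n` steps of the scheme from `u`. -/
def evolve (f₁ f₂ : ℝ → ℝ) (lam₁ lam₂ dx dt : ℝ) (u : ℤ → ℝ) (n : ℕ) : ℤ → ℝ :=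
  (step f₁ f₂ lam₁ lam₂ dx dt)^[n] u

/-- Total variation of a grid function, with value `∞` if the sum diverges. -/
def gridTV (u : ℤ → ℝ) : ℝ≥0∞ := ∑' j : ℤ, ENNReal.ofReal |u (j + 1) - u j|

/-- Cell averages of `u₀` over the cells `[j dx, (j + 1) dx]`; the node `x = 0` is the interface
of the cells `-1` and `0`. -/
def cellAverages (dx : ℝ) (u₀ : ℝ → ℝ) (j : ℤ) : ℝ :=
  1 / dx * ∫ x in (j * dx)..((j + 1) * dx), u₀ x

/-- The piecewise constant approximate solution: at `(x, t)` with `j dx ≤ x < (j + 1) dx` and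
`n dt ≤ t < (n + 1) dt` it has the value `u_j^n`, where `u^0` are the cell averages of `u₀`. -/
def approxSolution (f₁ f₂ : ℝ → ℝ) (lam₁ lam₂ dx dt : ℝ) (u₀ : ℝ → ℝ) (p : ℝ × ℝ) : ℝ :=
  evolve f₁ f₂ lam₁ lam₂ dx dt (cellAverages dx u₀) ⌊p.2 / dt⌋₊ ⌊p.1 / dx⌋

/-- `u = u(x, t)` is a (bounded) weak solution on `ℝ × (0, ∞)` of `∂ₜ u + ∂ₓ f(u) = 0` with
initial data `u₀`. Test functions are `C¹` with compact support in `ℝ × ℝ`, hence need not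
vanish at `t = 0`. -/
structure IsWeakSolution (f u₀ : ℝ → ℝ) (u : ℝ × ℝ → ℝ) : Prop where
  aestronglyMeasurable : AEStronglyMeasurable u (volume.restrict (univ ×ˢ Ioi (0 : ℝ)))
  bounded : ∃ M : ℝ, ∀ᵐ p ∂(volume.restrict ((univ : Set ℝ) ×ˢ Ioi (0 : ℝ))), |u p| ≤ M
  weak : ∀ φ : ℝ × ℝ → ℝ, ContDiff ℝ 1 φ → HasCompactSupport φ →
    (∫ p in (univ : Set ℝ) ×ˢ Ioi (0 : ℝ),
        (u p * fderiv ℝ φ p (0, 1) + f (u p) * fderiv ℝ φ p (1, 0)))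
      + (∫ x : ℝ, u₀ x * φ (x, 0)) = 0

/-- The `L¹(ℝ × (0, T))` distance of `u` and `w`. -/
def l1Dist (T : ℝ) (u w : ℝ × ℝ → ℝ) : ℝ≥0∞ :=
  ∫⁻ p in (univ : Set ℝ) ×ˢ Ioo (0 : ℝ) T, ‖u p - w p‖ₑ

end CentralScheme

end

noncomputable section

namespace CentralScheme

theorem onEdge_self {β : Type} (a : β) (j : ℤ) : onEdge a a j = a := by
  simp [onEdge]

theorem minmod_bounds_left {a b c : ℝ} :
    (0 ≤ a → 0 ≤ minmod a b c ∧ minmod a b c ≤ a) ∧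
      (a ≤ 0 → a ≤ minmod a b c ∧ minmod a b c ≤ 0) := by
  unfold minmod
  split_ifs with h1 h2
  · exact ⟨fun h => absurd h1.1 h.not_gt, fun _ => ⟨le_max_left _ _,
      max_le h1.1.le (max_le h1.2.1.le h1.2.2.le)⟩⟩
  · exact ⟨fun _ => ⟨le_min h2.1.le (le_min h2.2.1.le h2.2.2.le), min_le_left _ _⟩,
      fun h => absurd h2.1 h.not_gt⟩
  · exact ⟨fun h => ⟨le_rfl, h⟩, fun h => ⟨h, le_rfl⟩⟩

theorem minmod_reverse (a b c : ℝ) : minmod c b a = minmod a b c := by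
  have e1 : max c (max b a) = max a (max b c) := by
    rw [max_comm b a, max_left_comm, max_comm c b]
  have e2 : min c (min b a) = min a (min b c) := by
    rw [min_comm b a, min_left_comm, min_comm c b]
  have e3 : (c < 0 ∧ b < 0 ∧ a < 0) ↔ (a < 0 ∧ b < 0 ∧ c < 0) := by tauto
  have e4 : (0 < c ∧ 0 < b ∧ 0 < a) ↔ (0 < a ∧ 0 < b ∧ 0 < c) := by tauto
  simp only [minmod, e1, e2, e3, e4]

/-- A limited slope, multiplied by `dx`, lies between `0` and twice the one-sided increments. -/
structure SlopeBounds (w s : ℤ → ℝ) : Prop where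
  left_nonneg : ∀ j, 0 ≤ w j - w (j - 1) → 0 ≤ s j ∧ s j ≤ 2 * (w j - w (j - 1))
  left_nonpos : ∀ j, w j - w (j - 1) ≤ 0 → 2 * (w j - w (j - 1)) ≤ s j ∧ s j ≤ 0
  right_nonneg : ∀ j, 0 ≤ w (j + 1) - w j → 0 ≤ s j ∧ s j ≤ 2 * (w (j + 1) - w j)
  right_nonpos : ∀ j, w (j + 1) - w j ≤ 0 → 2 * (w (j + 1) - w j) ≤ s j ∧ s j ≤ 0

theorem slopeBounds_limited {dx : ℝ} (hdx : 0 < dx) (w : ℤ → ℝ) (P : ℤ → Prop)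
    [DecidablePred P] :
    SlopeBounds w (fun j => dx * if P j then 0 else mcSlope dx w j) := by
  have key : ∀ (x m : ℝ), (0 ≤ 2 * (x / dx) → 0 ≤ m ∧ m ≤ 2 * (x / dx)) ∧
      (2 * (x / dx) ≤ 0 → 2 * (x / dx) ≤ m ∧ m ≤ 0) →
      (0 ≤ x → 0 ≤ dx * m ∧ dx * m ≤ 2 * x) ∧ (x ≤ 0 → 2 * x ≤ dx * m ∧ dx * m ≤ 0) := by
    intro x m h
    have e : dx * (2 * (x / dx)) = 2 * x := by field_simp
    constructor
    · intro hx
      have := h.1 (by positivity)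
      exact ⟨mul_nonneg hdx.le this.1, e ▸ mul_le_mul_of_nonneg_left this.2 hdx.le⟩
    · intro hx
      have := h.2 (by have := div_nonpos_of_nonpos_of_nonneg hx hdx.le; linarith)
      exact ⟨e ▸ mul_le_mul_of_nonneg_left this.1 hdx.le,
        mul_nonpos_of_nonneg_of_nonpos hdx.le this.2⟩
  have zero : ∀ x : ℝ, (0 ≤ x → 0 ≤ dx * (0 : ℝ) ∧ dx * (0 : ℝ) ≤ 2 * x) ∧
      (x ≤ 0 → 2 * x ≤ dx * (0 : ℝ) ∧ dx * (0 : ℝ) ≤ 0) := by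
    intro x
    constructor <;> intro h <;> constructor <;> linarith
  have left : ∀ j, (0 ≤ w j - w (j - 1) → 0 ≤ dx * (if P j then 0 else mcSlope dx w j) ∧
      dx * (if P j then 0 else mcSlope dx w j) ≤ 2 * (w j - w (j - 1))) ∧
      (w j - w (j - 1) ≤ 0 → 2 * (w j - w (j - 1)) ≤ dx * (if P j then 0 else mcSlope dx w j) ∧
      dx * (if P j then 0 else mcSlope dx w j) ≤ 0) := by
    intro j
    split_ifs
    · exact zero _
    · exact key _ _ minmod_bounds_left
  have right : ∀ j, (0 ≤ w (j + 1) - w j → 0 ≤ dx * (if P j then 0 else mcSlope dx w j) ∧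
      dx * (if P j then 0 else mcSlope dx w j) ≤ 2 * (w (j + 1) - w j)) ∧
      (w (j + 1) - w j ≤ 0 → 2 * (w (j + 1) - w j) ≤ dx * (if P j then 0 else mcSlope dx w j) ∧
      dx * (if P j then 0 else mcSlope dx w j) ≤ 0) := by
    intro j
    split_ifs
    · exact zero _
    · refine key _ _ ?_
      rw [mcSlope, ← minmod_reverse]
      exact minmod_bounds_left
  exact ⟨fun j => (left j).1, fun j => (left j).2, fun j => (right j).1, fun j => (right j).2⟩

theorem slopeBounds_minus {dx : ℝ} (hdx : 0 < dx) (f : ℝ → ℝ) (lam : ℝ) (u : ℤ → ℝ) :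
    SlopeBounds (wMinus f f lam lam u) (fun j => dx * slopeMinus f f lam lam dx u j) :=
  slopeBounds_limited hdx _ (fun j => j = -1 ∨ j = 0)

theorem slopeBounds_plus {dx : ℝ} (hdx : 0 < dx) (f : ℝ → ℝ) (lam : ℝ) (u : ℤ → ℝ) :
    SlopeBounds (wPlus f f lam lam u) (fun j => dx * slopePlus f f lam lam dx u j) :=
  slopeBounds_limited hdx _ (fun j => j = -1 ∨ j = 0)

theorem wMinus_eq (f : ℝ → ℝ) (lam : ℝ) (u : ℤ → ℝ) (j : ℤ) :
    wMinus f f lam lam u j = 1 / 2 * f (u j) - lam / 2 * u j := by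
  simp [wMinus, onEdge_self]

theorem wPlus_eq (f : ℝ → ℝ) (lam : ℝ) (u : ℤ → ℝ) (j : ℤ) :
    wPlus f f lam lam u j = 1 / 2 * f (u j) + lam / 2 * u j := by
  simp [wPlus, onEdge_self]

theorem numFlux_eq (f : ℝ → ℝ) {lam : ℝ} (hlam : 0 < lam) (dx : ℝ) (u : ℤ → ℝ) (j : ℤ) :
    numFlux f f lam lam dx u j
      = wPlus f f lam lam u (j - 1) + dx * slopePlus f f lam lam dx u (j - 1) / 2
        + wMinus f f lam lam u j - dx * slopeMinus f f lam lam dx u j / 2 := by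
  rw [wMinus_eq, wPlus_eq]
  unfold numFlux
  split_ifs with h1 h2
  · ring
  · subst h2
    have e1 : slopeMinus f f lam lam dx u 0 = 0 := by simp [slopeMinus]
    have e2 : slopePlus f f lam lam dx u (0 - 1) = 0 := by simp [slopePlus]
    rw [e1, e2]
    norm_num
    field_simp
    ring
  · ring

theorem step_eq (f : ℝ → ℝ) {lam : ℝ} (hlam : 0 < lam) {dx : ℝ} (hdx : 0 < dx) (dt : ℝ)
    (u : ℤ → ℝ) (j : ℤ) :
    step f f lam lam dx dt u j
      = u j - dt / dx * (numFlux f f lam lam dx u (j + 1) - numFlux f f lam lam dx u j) := by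
  rw [numFlux_eq f hlam, numFlux_eq f hlam]
  simp only [wMinus_eq, wPlus_eq, add_sub_cancel_right]
  unfold step
  split_ifs with h1 h2
  · subst h1
    have e1 : slopeMinus f f lam lam dx u (-1 + 1) = 0 := by simp [slopeMinus]
    have e2 : slopePlus f f lam lam dx u (-1) = 0 := by simp [slopePlus]
    rw [e1, e2]
    simp only [relaxationRS]
    norm_num
    field_simp
    ring
  · subst h2
    have e1 : slopeMinus f f lam lam dx u 0 = 0 := by simp [slopeMinus]
    have e2 : slopePlus f f lam lam dx u (0 - 1) = 0 := by simp [slopePlus]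
    rw [e1, e2]
    simp only [relaxationRS]
    norm_num
    field_simp
    ring
  · simp only [onEdge_self]
    field_simp
    ring

theorem numFlux_const (f : ℝ → ℝ) {lam : ℝ} (hlam : 0 < lam) (dx c : ℝ) (j : ℤ) :
    numFlux f f lam lam dx (fun _ => c) j = f c := by
  have e1 : ∀ i, slopeMinus f f lam lam dx (fun _ => c) i = 0 := by
    intro i; simp [slopeMinus, mcSlope, minmod, wMinus_eq]
  have e2 : ∀ i, slopePlus f f lam lam dx (fun _ => c) i = 0 := by
    intro i; simp [slopePlus, mcSlope, minmod, wPlus_eq]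
  rw [numFlux_eq f hlam, e1, e2, wMinus_eq, wPlus_eq]
  ring

/-- Under the subcharacteristic condition the flux is `lam`-Lipschitz. -/
theorem abs_flux_sub_le {f : ℝ → ℝ} (hf : ContDiff ℝ 1 f) {lam : ℝ} {I : Set ℝ}
    (hI : I.OrdConnected) (hsub : ∀ u ∈ I, -lam ≤ deriv f u ∧ deriv f u ≤ lam)
    {a b : ℝ} (ha : a ∈ I) (hb : b ∈ I) : |f b - f a| ≤ lam * |b - a| :=
  Convex.norm_image_sub_le_of_norm_deriv_le
    (fun _ _ => (hf.differentiable one_ne_zero).differentiableAt)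
    (fun x hx => abs_le.2 (hsub x hx)) hI.convex ha hb

theorem abs_numFlux_sub_le {f : ℝ → ℝ} {lam : ℝ} (hlam : 0 < lam) {I : Set ℝ}
    (hlip : ∀ a ∈ I, ∀ b ∈ I, |f b - f a| ≤ lam * |b - a|)
    {dx : ℝ} (hdx : 0 < dx) {u : ℤ → ℝ} (hu : ∀ i, u i ∈ I) {c : ℝ} (hc : c ∈ I) {j : ℤ} {r : ℝ}
    (hr : ∀ i ∈ Finset.Icc (j - 2) (j + 1), |u i - c| ≤ r) :
    |numFlux f f lam lam dx u j - f c| ≤ 6 * lam * r := by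
  have hfc : ∀ i ∈ Finset.Icc (j - 2) (j + 1), |f (u i) - f c| ≤ lam * r := fun i hi =>
    (hlip c hc _ (hu i)).trans (mul_le_mul_of_nonneg_left (hr i hi) hlam.le)
  have hw : ∀ i ∈ Finset.Icc (j - 2) (j + 1),
      |wPlus f f lam lam u i - (1 / 2 * f c + lam / 2 * c)| ≤ lam * r ∧
      |wMinus f f lam lam u i - (1 / 2 * f c - lam / 2 * c)| ≤ lam * r := by
    intro i hi
    have h1 := abs_le.1 (hfc i hi)
    have h2 : |lam * (u i - c)| ≤ lam * r := by
      rw [abs_mul, abs_of_pos hlam]; exact mul_le_mul_of_nonneg_left (hr i hi) hlam.le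
    have h2 := abs_le.1 h2
    rw [wMinus_eq, wPlus_eq]
    constructor <;> rw [abs_le] <;> constructor <;> linarith
  have sl : ∀ {w s : ℤ → ℝ}, SlopeBounds w s → ∀ i, |s i| ≤ 2 * |w i - w (i - 1)| ∧
      |s i| ≤ 2 * |w (i + 1) - w i| := by
    intro w s h i
    constructor
    · rcases le_total 0 (w i - w (i - 1)) with h0 | h0
      · have := h.left_nonneg i h0
        rw [abs_of_nonneg h0, abs_of_nonneg this.1]; exact this.2
      · have := h.left_nonpos i h0
        rw [abs_of_nonpos h0, abs_of_nonpos this.2]; linarith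
    · rcases le_total 0 (w (i + 1) - w i) with h0 | h0
      · have := h.right_nonneg i h0
        rw [abs_of_nonneg h0, abs_of_nonneg this.1]; exact this.2
      · have := h.right_nonpos i h0
        rw [abs_of_nonpos h0, abs_of_nonpos this.2]; linarith
  have s1 := (sl (slopeBounds_plus hdx f lam u) (j - 1)).2
  have s2 := (sl (slopeBounds_minus hdx f lam u) j).1
  have m1 : j - 1 ∈ Finset.Icc (j - 2) (j + 1) := by rw [Finset.mem_Icc]; omega
  have m2 : j ∈ Finset.Icc (j - 2) (j + 1) := by rw [Finset.mem_Icc]; omega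
  rw [sub_add_cancel] at s1
  have a1 : |wPlus f f lam lam u j - wPlus f f lam lam u (j - 1)| ≤ 2 * (lam * r) := by
    have := abs_le.1 (hw _ m1).1
    have := abs_le.1 (hw _ m2).1
    rw [abs_le]; constructor <;> linarith
  have a2 : |wMinus f f lam lam u j - wMinus f f lam lam u (j - 1)| ≤ 2 * (lam * r) := by
    have := abs_le.1 (hw _ m1).2
    have := abs_le.1 (hw _ m2).2
    rw [abs_le]; constructor <;> linarith
  have b1 := abs_le.1 (s1.trans (mul_le_mul_of_nonneg_left a1 two_pos.le))
  have b2 := abs_le.1 (s2.trans (mul_le_mul_of_nonneg_left a2 two_pos.le))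
  have c1 := abs_le.1 (hw _ m1).1
  have c2 := abs_le.1 (hw _ m2).2
  rw [numFlux_eq f hlam, abs_le]
  constructor <;> linarith

/-- The increments `p j`, `q j` are the contributions of the interface right of cell `j` to the
cells `j + 1` and `j`. -/
structure IncrementForm (μ : ℝ) (u u' p q : ℤ → ℝ) : Prop where
  update : ∀ j, u' j = u j - p (j - 1) + q j
  abs_add_le : ∀ j, |p j| + |q j| ≤ μ * |u (j + 1) - u j|
  abs_sub_le : ∀ j, |u (j + 1) - u j - p j - q j| + |p j| + |q j| ≤ |u (j + 1) - u j|

theorem limited_increment {w s : ℤ → ℝ} (h : SlopeBounds w s) (j : ℤ) :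
    (0 ≤ w (j + 1) - w j → 0 ≤ w (j + 1) - w j + (s (j + 1) - s j) / 2 ∧
      w (j + 1) - w j + (s (j + 1) - s j) / 2 ≤ 2 * (w (j + 1) - w j) ∧
      0 ≤ w (j + 1) - w j - (s (j + 1) - s j) / 2 ∧
      w (j + 1) - w j - (s (j + 1) - s j) / 2 ≤ 2 * (w (j + 1) - w j)) ∧
    (w (j + 1) - w j ≤ 0 → w (j + 1) - w j + (s (j + 1) - s j) / 2 ≤ 0 ∧
      2 * (w (j + 1) - w j) ≤ w (j + 1) - w j + (s (j + 1) - s j) / 2 ∧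
      w (j + 1) - w j - (s (j + 1) - s j) / 2 ≤ 0 ∧
      2 * (w (j + 1) - w j) ≤ w (j + 1) - w j - (s (j + 1) - s j) / 2) := by
  have a := h.left_nonneg (j + 1)
  have b := h.left_nonpos (j + 1)
  rw [add_sub_cancel_right] at a b
  have c := h.right_nonneg j
  have d := h.right_nonpos j
  constructor
  · intro h0
    have a := a h0
    have c := c h0
    refine ⟨?_, ?_, ?_, ?_⟩ <;> linarith
  · intro h0
    have b := b h0
    have d := d h0
    refine ⟨?_, ?_, ?_, ?_⟩ <;> linarith

set_option maxHeartbeats 1000000 in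
theorem exists_incrementForm {f : ℝ → ℝ} {lam : ℝ} (hlam : 0 < lam) {I : Set ℝ}
    (hI : I.OrdConnected) (hlip : ∀ a ∈ I, ∀ b ∈ I, |f b - f a| ≤ lam * |b - a|)
    {dx dt : ℝ} (hdx : 0 < dx) (hdt : 0 < dt) (hcfl : lam * dt ≤ dx / 2)
    {u : ℤ → ℝ} (hu : ∀ i, u i ∈ I) :
    (∃ p q, IncrementForm (2 * lam * dt / dx) u (step f f lam lam dx dt u) p q) ∧
      ∀ j, step f f lam lam dx dt u j ∈ I := by
  set wp := wPlus f f lam lam u with hwp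
  set wm := wMinus f f lam lam u with hwm
  have hsp := slopeBounds_plus hdx f lam u
  have hsm := slopeBounds_minus hdx f lam u
  rw [← hwp] at hsp
  rw [← hwm] at hsm
  set sp := fun j => dx * slopePlus f f lam lam dx u j with hsp_def
  set sm := fun j => dx * slopeMinus f f lam lam dx u j with hsm_def
  set c := dt / dx with hc
  have hc0 : 0 < c := div_pos hdt hdx
  have hcl : c * lam ≤ 1 / 2 := by
    rw [hc, div_mul_eq_mul_div, div_le_iff₀ hdx]; linarith
  have hμ : 2 * lam * dt / dx = 2 * (c * lam) := by rw [hc]; ring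
  let p : ℤ → ℝ := fun j => c * (wp (j + 1) - wp j + (sp (j + 1) - sp j) / 2)
  let q : ℤ → ℝ := fun j => -(c * (wm (j + 1) - wm j - (sm (j + 1) - sm j) / 2))
  have hupd : ∀ j, step f f lam lam dx dt u j = u j - p (j - 1) + q j := by
    intro j
    rw [step_eq f hlam hdx, numFlux_eq f hlam, numFlux_eq f hlam, ← hwp, ← hwm]
    simp only [p, q, hsp_def, hsm_def, hc, sub_add_cancel, add_sub_cancel_right]
    ring
  have hDw : ∀ j, (wp (j + 1) - wp j) - (wm (j + 1) - wm j) = lam * (u (j + 1) - u j) := by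
    intro j; simp only [hwp, hwm, wPlus_eq, wMinus_eq]; ring
  have hmono : ∀ j, (0 ≤ u (j + 1) - u j → 0 ≤ wp (j + 1) - wp j ∧ wm (j + 1) - wm j ≤ 0) ∧
      (u (j + 1) - u j ≤ 0 → wp (j + 1) - wp j ≤ 0 ∧ 0 ≤ wm (j + 1) - wm j) := by
    intro j
    have h1 := hlip _ (hu j) _ (hu (j + 1))
    simp only [hwp, hwm, wPlus_eq, wMinus_eq]
    constructor
    · intro h0
      rw [abs_of_nonneg h0] at h1
      have := abs_le.1 h1
      constructor <;> linarith
    · intro h0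
      rw [abs_of_nonpos h0] at h1
      have := abs_le.1 h1
      constructor <;> linarith
  have hpos : ∀ j, 0 ≤ u (j + 1) - u j → 0 ≤ p j ∧ 0 ≤ q j ∧
      p j + q j ≤ 2 * (c * lam) * (u (j + 1) - u j) := by
    intro j h0
    obtain ⟨h1, h2⟩ := (hmono j).1 h0
    have l1 := (limited_increment hsp j).1 h1
    have l2 := (limited_increment hsm j).2 h2
    refine ⟨mul_nonneg hc0.le l1.1, ?_, ?_⟩
    · have := mul_nonpos_of_nonneg_of_nonpos hc0.le l2.2.2.1
      simp only [q]; linarith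
    · have e : 2 * (c * lam) * (u (j + 1) - u j)
          = c * (2 * ((wp (j + 1) - wp j) - (wm (j + 1) - wm j))) := by rw [hDw]; ring
      rw [e]
      have := mul_le_mul_of_nonneg_left (show (wp (j + 1) - wp j + (sp (j + 1) - sp j) / 2)
        - (wm (j + 1) - wm j - (sm (j + 1) - sm j) / 2)
        ≤ 2 * ((wp (j + 1) - wp j) - (wm (j + 1) - wm j)) by linarith) hc0.le
      simp only [p, q]; linarith
  have hneg : ∀ j, u (j + 1) - u j ≤ 0 → p j ≤ 0 ∧ q j ≤ 0 ∧
      2 * (c * lam) * (u (j + 1) - u j) ≤ p j + q j := by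
    intro j h0
    obtain ⟨h1, h2⟩ := (hmono j).2 h0
    have l1 := (limited_increment hsp j).2 h1
    have l2 := (limited_increment hsm j).1 h2
    refine ⟨mul_nonpos_of_nonneg_of_nonpos hc0.le l1.1, ?_, ?_⟩
    · have := mul_nonneg hc0.le l2.2.2.1
      simp only [q]; linarith
    · have e : 2 * (c * lam) * (u (j + 1) - u j)
          = c * (2 * ((wp (j + 1) - wp j) - (wm (j + 1) - wm j))) := by rw [hDw]; ring
      rw [e]
      have := mul_le_mul_of_nonneg_left (show
        2 * ((wp (j + 1) - wp j) - (wm (j + 1) - wm j))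
        ≤ (wp (j + 1) - wp j + (sp (j + 1) - sp j) / 2)
        - (wm (j + 1) - wm j - (sm (j + 1) - sm j) / 2) by linarith) hc0.le
      simp only [p, q]; linarith
  have hle : ∀ j, 0 ≤ u (j + 1) - u j →
      2 * (c * lam) * (u (j + 1) - u j) ≤ u (j + 1) - u j := fun j h0 => by nlinarith
  have half_pos : ∀ x : ℝ, 0 ≤ x → c * (lam * x) ≤ x / 2 := fun x h0 => by nlinarith
  have half_neg : ∀ x : ℝ, x ≤ 0 → x / 2 ≤ c * (lam * x) := fun x h0 => by nlinarith
  have hge : ∀ j, u (j + 1) - u j ≤ 0 →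
      u (j + 1) - u j ≤ 2 * (c * lam) * (u (j + 1) - u j) := fun j h0 => by nlinarith
  refine ⟨⟨p, q, hupd, ?_, ?_⟩, ?_⟩
  · intro j
    rw [hμ]
    rcases le_total 0 (u (j + 1) - u j) with h0 | h0
    · obtain ⟨h1, h2, h3⟩ := hpos j h0
      rw [abs_of_nonneg h0, abs_of_nonneg h1, abs_of_nonneg h2]; exact h3
    · obtain ⟨h1, h2, h3⟩ := hneg j h0
      rw [abs_of_nonpos h0, abs_of_nonpos h1, abs_of_nonpos h2]; linarith
  · intro j
    rcases le_total 0 (u (j + 1) - u j) with h0 | h0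
    · obtain ⟨h1, h2, h3⟩ := hpos j h0
      have := hle j h0
      rw [abs_of_nonneg h0, abs_of_nonneg h1, abs_of_nonneg h2, abs_of_nonneg (by linarith)]
      linarith
    · obtain ⟨h1, h2, h3⟩ := hneg j h0
      have := hge j h0
      rw [abs_of_nonpos h0, abs_of_nonpos h1, abs_of_nonpos h2, abs_of_nonpos (by linarith)]
      linarith
  · intro j
    rw [hupd]
    have pj := hpos (j - 1)
    have nj := hneg (j - 1)
    have lj := hle (j - 1)
    have gj := hge (j - 1)
    have mj := hmono (j - 1)
    have ej := hDw (j - 1)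
    rw [sub_add_cancel] at pj nj lj gj mj ej
    rcases le_total 0 (u j - u (j - 1)) with h0 | h0 <;>
      rcases le_total 0 (u (j + 1) - u j) with h1 | h1
    · have a := pj h0
      have b := hpos j h1
      have := lj h0
      have := hle j h1
      exact hI.out (hu (j - 1)) (hu (j + 1)) ⟨by linarith, by linarith⟩
    · -- at a local maximum the slopes vanish, and the update is at most half of each increment
      have m0 := mj.1 h0
      have m1 := (hmono j).2 h1
      have s1 := hsp.left_nonneg j m0.1
      have s2 := hsp.right_nonpos j m1.1
      have s3 := hsm.left_nonpos j m0.2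
      have s4 := hsm.right_nonneg j m1.2
      have s5 := hsp.right_nonneg (j - 1)
      have s6 := hsm.left_nonneg (j + 1)
      rw [sub_add_cancel] at s5
      rw [add_sub_cancel_right] at s6
      have s5 := s5 m0.1
      have s6 := s6 m1.2
      have a := pj h0
      have b := hneg j h1
      have kp : p (j - 1) ≤ (u j - u (j - 1)) / 2 := by
        have : p (j - 1) ≤ c * (lam * (u j - u (j - 1))) := by
          simp only [p, sub_add_cancel]
          exact mul_le_mul_of_nonneg_left (by linarith) hc0.le
        exact this.trans (half_pos _ h0)
      have kq : (u (j + 1) - u j) / 2 ≤ q j := by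
        have : c * (lam * (u (j + 1) - u j)) ≤ q j := by
          simp only [q]
          rw [← mul_neg]
          have := hDw j
          exact mul_le_mul_of_nonneg_left (by linarith) hc0.le
        exact (half_neg _ h1).trans this
      rcases le_total (u (j - 1)) (u (j + 1)) with h2 | h2
      · exact hI.out (hu (j - 1)) (hu j) ⟨by linarith, by linarith⟩
      · exact hI.out (hu (j + 1)) (hu j) ⟨by linarith, by linarith⟩
    · have m0 := mj.2 h0
      have m1 := (hmono j).1 h1
      have s1 := hsp.left_nonpos j m0.1
      have s2 := hsp.right_nonneg j m1.1
      have s3 := hsm.left_nonneg j m0.2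
      have s4 := hsm.right_nonpos j m1.2
      have s5 := hsp.right_nonpos (j - 1)
      have s6 := hsm.left_nonpos (j + 1)
      rw [sub_add_cancel] at s5
      rw [add_sub_cancel_right] at s6
      have s5 := s5 m0.1
      have s6 := s6 m1.2
      have a := nj h0
      have b := hpos j h1
      have kp : (u j - u (j - 1)) / 2 ≤ p (j - 1) := by
        have : c * (lam * (u j - u (j - 1))) ≤ p (j - 1) := by
          simp only [p, sub_add_cancel]
          exact mul_le_mul_of_nonneg_left (by linarith) hc0.le
        exact (half_neg _ h0).trans this
      have kq : q j ≤ (u (j + 1) - u j) / 2 := by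
        have : q j ≤ c * (lam * (u (j + 1) - u j)) := by
          simp only [q]
          rw [← mul_neg]
          have := hDw j
          exact mul_le_mul_of_nonneg_left (by linarith) hc0.le
        exact this.trans (half_pos _ h1)
      rcases le_total (u (j - 1)) (u (j + 1)) with h2 | h2
      · exact hI.out (hu j) (hu (j + 1)) ⟨by linarith, by linarith⟩
      · exact hI.out (hu j) (hu (j - 1)) ⟨by linarith, by linarith⟩
    · have a := nj h0
      have b := hneg j h1
      have := gj h0
      have := hge j h1
      exact hI.out (hu (j + 1)) (hu (j - 1)) ⟨by linarith, by linarith⟩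

/-- Total variation of a grid function with a weight on each interface. -/
def weightedTV (χ : ℤ → ℝ≥0∞) (u : ℤ → ℝ) : ℝ≥0∞ := ∑' j : ℤ, χ j * ‖u (j + 1) - u j‖ₑ

theorem gridTV_eq_tsum_enorm (u : ℤ → ℝ) : gridTV u = ∑' j : ℤ, ‖u (j + 1) - u j‖ₑ := by
  simp [gridTV, Real.enorm_eq_ofReal_abs]

theorem weightedTV_one (u : ℤ → ℝ) : weightedTV (fun _ => 1) u = gridTV u := by
  simp [gridTV_eq_tsum_enorm, weightedTV]

theorem tsum_shift_succ (a : ℤ → ℝ≥0∞) : ∑' j, a (j + 1) = ∑' j, a j :=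
  (Equiv.addRight (1 : ℤ)).tsum_eq a

theorem tsum_shift_pred (a : ℤ → ℝ≥0∞) : ∑' j, a (j - 1) = ∑' j, a j :=
  (Equiv.subRight (1 : ℤ)).tsum_eq a

namespace IncrementForm

variable {μ : ℝ} {u u' p q : ℤ → ℝ}

theorem enorm_add_le (h : IncrementForm μ u u' p q) (j : ℤ) :
    ‖p j‖ₑ + ‖q j‖ₑ ≤ ENNReal.ofReal μ * ‖u (j + 1) - u j‖ₑ := by
  simp only [Real.enorm_eq_ofReal_abs]
  rw [← ENNReal.ofReal_add (abs_nonneg _) (abs_nonneg _), ← ENNReal.ofReal_mul' (abs_nonneg _)]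
  exact ENNReal.ofReal_le_ofReal (h.abs_add_le j)

theorem enorm_sub_le (h : IncrementForm μ u u' p q) (j : ℤ) :
    ‖u (j + 1) - u j - p j - q j‖ₑ + ‖p j‖ₑ + ‖q j‖ₑ ≤ ‖u (j + 1) - u j‖ₑ := by
  simp only [Real.enorm_eq_ofReal_abs]
  rw [← ENNReal.ofReal_add (abs_nonneg _) (abs_nonneg _),
    ← ENNReal.ofReal_add (by positivity) (abs_nonneg _)]
  exact ENNReal.ofReal_le_ofReal (h.abs_sub_le j)

theorem tsum_increments_le (h : IncrementForm μ u u' p q) :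
    ∑' j, (‖p j‖ₑ + ‖q j‖ₑ) ≤ ENNReal.ofReal μ * gridTV u := by
  rw [gridTV_eq_tsum_enorm, ← ENNReal.tsum_mul_left]
  exact ENNReal.tsum_le_tsum h.enorm_add_le

theorem weightedTV_le (h : IncrementForm μ u u' p q) {χ : ℤ → ℝ≥0∞} {κ : ℝ≥0∞}
    (h₁ : ∀ j, χ (j + 1) ≤ χ j + κ) (h₂ : ∀ j, χ j ≤ χ (j + 1) + κ) :
    weightedTV χ u' ≤ weightedTV χ u + κ * (ENNReal.ofReal μ * gridTV u) := by
  calc weightedTV χ u'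
      ≤ ∑' j, (χ j * ‖u (j + 1) - u j - p j - q j‖ₑ + χ (j - 1 + 1) * ‖p (j - 1)‖ₑ
          + χ (j + 1 - 1) * ‖q (j + 1)‖ₑ) := by
        refine ENNReal.tsum_le_tsum fun j => ?_
        rw [sub_add_cancel, add_sub_cancel_right, ← mul_add, ← mul_add]
        refine mul_le_mul_right (le_trans (le_of_eq ?_) (_root_.enorm_add_le _ _ |>.trans
          (add_le_add_left (_root_.enorm_add_le _ _) _))) _
        congr 1
        rw [h.update, h.update, add_sub_cancel_right]
        ring
    _ = ∑' j, (χ j * ‖u (j + 1) - u j - p j - q j‖ₑ + χ (j + 1) * ‖p j‖ₑ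
          + χ (j - 1) * ‖q j‖ₑ) := by
        rw [ENNReal.tsum_add, ENNReal.tsum_add, ENNReal.tsum_add, ENNReal.tsum_add,
          tsum_shift_pred (fun j => χ (j + 1) * ‖p j‖ₑ),
          tsum_shift_succ (fun j => χ (j - 1) * ‖q j‖ₑ)]
    _ ≤ ∑' j, (χ j * ‖u (j + 1) - u j‖ₑ + κ * (‖p j‖ₑ + ‖q j‖ₑ)) := by
        refine ENNReal.tsum_le_tsum fun j => ?_
        have h₃ := h₂ (j - 1)
        rw [sub_add_cancel] at h₃
        calc _ ≤ χ j * ‖u (j + 1) - u j - p j - q j‖ₑ + (χ j + κ) * ‖p j‖ₑ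
                + (χ j + κ) * ‖q j‖ₑ := by gcongr; exact h₁ j
          _ = χ j * (‖u (j + 1) - u j - p j - q j‖ₑ + ‖p j‖ₑ + ‖q j‖ₑ)
                + κ * (‖p j‖ₑ + ‖q j‖ₑ) := by ring
          _ ≤ _ := by gcongr; exact h.enorm_sub_le j
    _ ≤ _ := by
        rw [ENNReal.tsum_add, ENNReal.tsum_mul_left]
        exact add_le_add le_rfl (mul_le_mul_right h.tsum_increments_le _)

theorem gridTV_le (h : IncrementForm μ u u' p q) : gridTV u' ≤ gridTV u := by
  have := h.weightedTV_le (χ := fun _ => 1) (κ := 0) (by simp) (by simp)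
  simpa [weightedTV_one] using this

theorem tsum_change_le (h : IncrementForm μ u u' p q) {χ : ℤ → ℝ≥0∞} {κ : ℝ≥0∞}
    (h₁ : ∀ j, χ (j + 1) ≤ χ j + κ) :
    ∑' j, χ j * ‖u' j - u j‖ₑ ≤ ENNReal.ofReal μ * (weightedTV χ u + κ * gridTV u) := by
  calc ∑' j, χ j * ‖u' j - u j‖ₑ
      ≤ ∑' j, (χ (j - 1 + 1) * ‖p (j - 1)‖ₑ + χ j * ‖q j‖ₑ) := by
        refine ENNReal.tsum_le_tsum fun j => ?_
        rw [sub_add_cancel, ← mul_add, h.update]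
        refine mul_le_mul_right ?_ _
        calc ‖u j - p (j - 1) + q j - u j‖ₑ = ‖-p (j - 1) + q j‖ₑ := by congr 1; ring
          _ ≤ _ := (_root_.enorm_add_le _ _).trans (by rw [enorm_neg])
    _ = ∑' j, (χ (j + 1) * ‖p j‖ₑ + χ j * ‖q j‖ₑ) := by
        rw [ENNReal.tsum_add, ENNReal.tsum_add, tsum_shift_pred (fun j => χ (j + 1) * ‖p j‖ₑ)]
    _ ≤ ∑' j, (ENNReal.ofReal μ * (χ j * ‖u (j + 1) - u j‖ₑ)
          + ENNReal.ofReal μ * (κ * ‖u (j + 1) - u j‖ₑ)) := by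
        refine ENNReal.tsum_le_tsum fun j => ?_
        calc χ (j + 1) * ‖p j‖ₑ + χ j * ‖q j‖ₑ ≤ (χ j + κ) * ‖p j‖ₑ + (χ j + κ) * ‖q j‖ₑ := by
              gcongr
              · exact h₁ j
              · exact le_self_add
          _ = (χ j + κ) * (‖p j‖ₑ + ‖q j‖ₑ) := by ring
          _ ≤ (χ j + κ) * (ENNReal.ofReal μ * ‖u (j + 1) - u j‖ₑ) := by
              gcongr; exact h.enorm_add_le j
          _ = _ := by ring
    _ = _ := by
        rw [ENNReal.tsum_add, ENNReal.tsum_mul_left, ENNReal.tsum_mul_left, ENNReal.tsum_mul_left,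
          mul_add, weightedTV, gridTV_eq_tsum_enorm]

end IncrementForm

/-- A sequence of grid functions such that each is obtained from its predecessor by an update in
increment form. -/
def IsIncrementSeq (μ : ℝ) (v : ℕ → ℤ → ℝ) : Prop :=
  ∀ n, ∃ p q, IncrementForm μ (v n) (v (n + 1)) p q

namespace IsIncrementSeq

variable {μ : ℝ} {v : ℕ → ℤ → ℝ}

theorem gridTV_le (h : IsIncrementSeq μ v) (n : ℕ) : gridTV (v n) ≤ gridTV (v 0) := by
  induction n with
  | zero => exact le_rfl
  | succ n ih =>
    obtain ⟨p, q, hpq⟩ := h n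
    exact hpq.gridTV_le.trans ih

theorem weightedTV_le (h : IsIncrementSeq μ v) {χ : ℤ → ℝ≥0∞} {κ : ℝ≥0∞}
    (h₁ : ∀ j, χ (j + 1) ≤ χ j + κ) (h₂ : ∀ j, χ j ≤ χ (j + 1) + κ) (n : ℕ) :
    weightedTV χ (v n) ≤ weightedTV χ (v 0) + n * (κ * (ENNReal.ofReal μ * gridTV (v 0))) := by
  induction n with
  | zero => simp
  | succ n ih =>
    obtain ⟨p, q, hpq⟩ := h n
    calc _ ≤ weightedTV χ (v n) + κ * (ENNReal.ofReal μ * gridTV (v n)) := hpq.weightedTV_le h₁ h₂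
      _ ≤ (weightedTV χ (v 0) + n * (κ * (ENNReal.ofReal μ * gridTV (v 0))))
          + κ * (ENNReal.ofReal μ * gridTV (v 0)) := by gcongr; exact h.gridTV_le n
      _ = _ := by push_cast; ring

theorem tsum_change_le (h : IsIncrementSeq μ v) {χ : ℤ → ℝ≥0∞} {κ B : ℝ≥0∞}
    (h₁ : ∀ j, χ (j + 1) ≤ χ j + κ) (m n : ℕ)
    (hB : ∀ i < m + n, weightedTV χ (v i) + κ * gridTV (v i) ≤ B) :
    ∑' j, χ j * ‖v (m + n) j - v m j‖ₑ ≤ n * (ENNReal.ofReal μ * B) := by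
  induction n with
  | zero => simp
  | succ n ih =>
    obtain ⟨p, q, hpq⟩ := h (m + n)
    calc ∑' j, χ j * ‖v (m + n + 1) j - v m j‖ₑ
        ≤ ∑' j, (χ j * ‖v (m + n) j - v m j‖ₑ + χ j * ‖v (m + n + 1) j - v (m + n) j‖ₑ) := by
          refine ENNReal.tsum_le_tsum fun j => ?_
          rw [← mul_add]
          refine mul_le_mul_right ?_ _
          rw [← sub_add_sub_cancel' (v (m + n) j)]
          exact enorm_add_le _ _
      _ ≤ n * (ENNReal.ofReal μ * B) + ENNReal.ofReal μ * B := by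
          rw [ENNReal.tsum_add]
          refine add_le_add (ih fun i hi => hB i (by omega)) ((hpq.tsum_change_le h₁).trans ?_)
          exact mul_le_mul_right (hB (m + n) (by omega)) _
      _ = _ := by push_cast; ring

theorem tsum_change_le_gridTV (h : IsIncrementSeq μ v) (m n : ℕ) :
    ∑' j, ‖v (m + n) j - v m j‖ₑ ≤ n * (ENNReal.ofReal μ * gridTV (v 0)) := by
  have := h.tsum_change_le (χ := fun _ => 1) (κ := 0) (B := gridTV (v 0)) (by simp) m n
    (fun i _ => by simpa [weightedTV_one] using h.gridTV_le i)
  simpa using this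

end IsIncrementSeq

theorem evolve_succ (f : ℝ → ℝ) (lam dx dt : ℝ) (u : ℤ → ℝ) (n : ℕ) :
    evolve f f lam lam dx dt u (n + 1)
      = step f f lam lam dx dt (evolve f f lam lam dx dt u n) :=
  Function.iterate_succ_apply' _ _ _

theorem evolve_mem {f : ℝ → ℝ} {lam : ℝ} (hlam : 0 < lam) {I : Set ℝ}
    (hI : I.OrdConnected) (hlip : ∀ a ∈ I, ∀ b ∈ I, |f b - f a| ≤ lam * |b - a|)
    {dx dt : ℝ} (hdx : 0 < dx) (hdt : 0 < dt) (hcfl : lam * dt ≤ dx / 2)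
    {u : ℤ → ℝ} (hu : ∀ i, u i ∈ I) (n : ℕ) : ∀ j, evolve f f lam lam dx dt u n j ∈ I := by
  induction n with
  | zero => exact hu
  | succ n ih =>
    rw [evolve_succ]
    exact (exists_incrementForm hlam hI hlip hdx hdt hcfl ih).2

theorem isIncrementSeq_evolve {f : ℝ → ℝ} {lam : ℝ} (hlam : 0 < lam) {I : Set ℝ}
    (hI : I.OrdConnected) (hlip : ∀ a ∈ I, ∀ b ∈ I, |f b - f a| ≤ lam * |b - a|)
    {dx dt : ℝ} (hdx : 0 < dx) (hdt : 0 < dt) (hcfl : lam * dt ≤ dx / 2)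
    {u : ℤ → ℝ} (hu : ∀ i, u i ∈ I) :
    IsIncrementSeq (2 * lam * dt / dx) (evolve f f lam lam dx dt u) := by
  intro n
  rw [evolve_succ]
  exact (exists_incrementForm hlam hI hlip hdx hdt hcfl
    (evolve_mem hlam hI hlip hdx hdt hcfl hu n)).1

/-- `g` is a monotone function, with values in `[0, K]`, whose increments dominate those of `u`. -/
structure VariationMajorant (u g : ℝ → ℝ) (K : ℝ) : Prop where
  mono : Monotone g
  nonneg : ∀ x, 0 ≤ g x
  le : ∀ x, g x ≤ K
  abs_sub_le : ∀ x y, x ≤ y → |u y - u x| ≤ g y - g x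

theorem exists_variationMajorant {u : ℝ → ℝ} (hu : BoundedVariationOn u univ) :
    ∃ g K, VariationMajorant u g K := by
  have hfin : ∀ s, eVariationOn u s ≠ ∞ := fun s => hu.mono (subset_univ s)
  refine ⟨fun x => (eVariationOn u (Iic x)).toReal, (eVariationOn u univ).toReal, ?_, ?_, ?_, ?_⟩
  · intro x y hxy
    exact ENNReal.toReal_mono (hfin _) (eVariationOn.mono _ (Iic_subset_Iic.2 hxy))
  · intro x
    exact ENNReal.toReal_nonneg
  · intro x
    exact ENNReal.toReal_mono (hfin _) (eVariationOn.mono _ (subset_univ _))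
  · intro x y hxy
    have h1 := eVariationOn.add_le_union u (s := Iic x) (t := Icc x y)
      (fun a ha b hb => le_trans ha hb.1)
    have h2 := h1.trans (eVariationOn.mono u
      (union_subset (Iic_subset_Iic.2 hxy) Icc_subset_Iic_self))
    have h3 := ENNReal.toReal_mono (hfin _) h2
    rw [ENNReal.toReal_add (hfin _) (hfin _)] at h3
    have h4 := BoundedVariationOn.dist_le (hfin (Icc x y)) (right_mem_Icc.2 hxy)
      (left_mem_Icc.2 hxy)
    rw [Real.dist_eq] at h4
    linarith

namespace VariationMajorant

variable {u g : ℝ → ℝ} {K : ℝ}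

theorem nonneg_bound (h : VariationMajorant u g K) : 0 ≤ K := (h.nonneg 0).trans (h.le 0)

theorem abs_sub_le_of_mem (h : VariationMajorant u g K) {a b x y : ℝ} (hx : x ∈ Icc a b)
    (hy : y ∈ Icc a b) : |u y - u x| ≤ g b - g a := by
  have ha := h.mono hx.1
  have ha' := h.mono hy.1
  have hb := h.mono hx.2
  have hb' := h.mono hy.2
  rcases le_total x y with hxy | hxy
  · linarith [h.abs_sub_le x y hxy]
  · rw [abs_sub_comm]; linarith [h.abs_sub_le y x hxy]

theorem abs_le (h : VariationMajorant u g K) (x : ℝ) : |u x| ≤ |u 0| + K := by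
  have h1 : |u x - u 0| ≤ K := by
    rcases le_total 0 x with hx | hx
    · linarith [h.abs_sub_le 0 x hx, h.le x, h.nonneg 0]
    · rw [abs_sub_comm]; linarith [h.abs_sub_le x 0 hx, h.le 0, h.nonneg x]
  have := abs_sub_abs_le_abs_sub (u x) (u 0)
  linarith

theorem measurable (h : VariationMajorant u g K) : Measurable u := by
  have h1 : Monotone (fun x => g x + u x) := fun x y hxy => by
    have := _root_.abs_le.1 (h.abs_sub_le x y hxy)
    change g x + u x ≤ g y + u y
    linarith
  have : u = fun x => (g x + u x) - g x := by ext x; ring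
  rw [this]
  exact h1.measurable.sub h.mono.measurable

theorem integrableOn (h : VariationMajorant u g K) {s : Set ℝ} (hs : volume s ≠ ∞) :
    IntegrableOn u s :=
  Measure.integrableOn_of_bounded hs h.measurable.aestronglyMeasurable
    (Eventually.of_forall fun x => h.abs_le x)

theorem exists_le_cellAverages_le (h : VariationMajorant u g K) {dx : ℝ} (hdx : 0 < dx) (j : ℤ) :
    (∃ x ∈ Icc (j * dx) ((j + 1) * dx), u x ≤ cellAverages dx u j) ∧
      ∃ x ∈ Icc (j * dx) ((j + 1) * dx), cellAverages dx u j ≤ u x := by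
  have hlt : (j : ℝ) * dx ≤ (j + 1) * dx := by nlinarith
  have hvol : volume (Ioc (j * dx) ((j + 1) * dx)) = ENNReal.ofReal dx := by
    rw [Real.volume_Ioc]; congr 1; ring
  have e : cellAverages dx u j = ⨍ x in Ioc (j * dx) ((j + 1) * dx), u x := by
    rw [setAverage_eq, cellAverages, intervalIntegral.integral_of_le hlt, measureReal_def, hvol,
      ENNReal.toReal_ofReal hdx.le, one_div, smul_eq_mul]
  have h0 : volume (Ioc (j * dx) ((j + 1) * dx)) ≠ 0 := by
    rw [hvol]; exact (ENNReal.ofReal_pos.2 hdx).ne'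
  have h1 : volume (Ioc (j * dx) ((j + 1) * dx)) ≠ ∞ := by
    rw [hvol]; exact ENNReal.ofReal_ne_top
  obtain ⟨x, hx, hx'⟩ := exists_le_setAverage h0 h1 (h.integrableOn h1)
  obtain ⟨y, hy, hy'⟩ := exists_setAverage_le h0 h1 (h.integrableOn h1)
  rw [e]
  exact ⟨⟨x, Ioc_subset_Icc_self hx, hx'⟩, ⟨y, Ioc_subset_Icc_self hy, hy'⟩⟩

theorem cellAverages_mem (h : VariationMajorant u g K) {I : Set ℝ} (hI : I.OrdConnected)
    (hu : ∀ x, u x ∈ I) {dx : ℝ} (hdx : 0 < dx) (j : ℤ) : cellAverages dx u j ∈ I := by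
  obtain ⟨⟨x, _, hx⟩, ⟨y, _, hy⟩⟩ := h.exists_le_cellAverages_le hdx j
  exact hI.out (hu x) (hu y) ⟨hx, hy⟩

theorem abs_cellAverages_sub_le (h : VariationMajorant u g K) {dx : ℝ} (hdx : 0 < dx) {j : ℤ}
    {x : ℝ} (hx : x ∈ Icc (j * dx) ((j + 1) * dx)) :
    |cellAverages dx u j - u x| ≤ g ((j + 1) * dx) - g (j * dx) := by
  obtain ⟨⟨y, hy, hy'⟩, ⟨z, hz, hz'⟩⟩ := h.exists_le_cellAverages_le hdx j
  have h1 := _root_.abs_le.1 (h.abs_sub_le_of_mem hx hy)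
  have h2 := _root_.abs_le.1 (h.abs_sub_le_of_mem hx hz)
  rw [_root_.abs_le]
  constructor <;> linarith

theorem abs_cellAverages_succ_sub_le (h : VariationMajorant u g K) {dx : ℝ} (hdx : 0 < dx)
    (j : ℤ) : |cellAverages dx u (j + 1) - cellAverages dx u j|
      ≤ g ((j + 2) * dx) - g (j * dx) := by
  have hx : ((j : ℝ) + 1) * dx ∈ Icc (j * dx) ((j + 1) * dx) := ⟨by nlinarith, le_rfl⟩
  have hy : ((j : ℝ) + 1) * dx ∈ Icc (((j + 1 : ℤ) : ℝ) * dx) (((j + 1 : ℤ) + 1) * dx) := by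
    push_cast; exact ⟨le_rfl, by nlinarith⟩
  have h1 := _root_.abs_le.1 (h.abs_cellAverages_sub_le hdx hx)
  have h2 := _root_.abs_le.1 (h.abs_cellAverages_sub_le hdx hy)
  push_cast at h2
  rw [add_assoc (j : ℝ), one_add_one_eq_two] at h2
  rw [_root_.abs_le]
  constructor <;> linarith

end VariationMajorant

theorem tsum_monotone_increments_le {G : ℤ → ℝ} (hG : Monotone G) {K : ℝ}
    (hK : ∀ j, |G j| ≤ K) : ∑' j, ENNReal.ofReal (G (j + 1) - G j) ≤ ENNReal.ofReal (4 * K) := by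
  have hK0 : 0 ≤ K := (abs_nonneg _).trans (hK 0)
  have half : ∀ H : ℕ → ℝ, (∀ n, 0 ≤ H (n + 1) - H n) → (∀ n, |H n| ≤ K) →
      ∑' n, ENNReal.ofReal (H (n + 1) - H n) ≤ ENNReal.ofReal (2 * K) := by
    intro H h0 hH
    refine ENNReal.tsum_le_of_sum_range_le fun n => ?_
    rw [← ENNReal.ofReal_sum_of_nonneg (fun i _ => h0 i), Finset.sum_range_sub]
    refine ENNReal.ofReal_le_ofReal ?_
    have h1 := abs_le.1 (hH n)
    have h2 := abs_le.1 (hH 0)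
    linarith
  have h1 := half (fun n => G n) (fun n => sub_nonneg.2 (hG (by push_cast; linarith)))
    (fun n => hK _)
  have h2 := half (fun n => -G (-(n : ℤ))) (fun n => sub_nonneg.2 (neg_le_neg (hG (by
    push_cast; linarith)))) (fun n => by rw [abs_neg]; exact hK _)
  rw [tsum_of_nat_of_neg_add_one ENNReal.summable ENNReal.summable,
    show 4 * K = 2 * K + 2 * K by ring, ENNReal.ofReal_add (by positivity) (by positivity)]
  refine add_le_add (by exact_mod_cast h1) (le_trans (le_of_eq ?_) h2)
  refine tsum_congr fun n => ?_
  congr 1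
  push_cast
  rw [neg_sub_neg]
  congr 2
  ring

theorem weightedTV_le_of_monotone {v : ℤ → ℝ} {χ : ℤ → ℝ≥0∞} (hχ : ∀ j, χ j ≤ 1) {G : ℤ → ℝ}
    (hG : Monotone G) {K : ℝ} (hK : ∀ j, |G j| ≤ K)
    (h : ∀ j, χ j ≠ 0 → |v (j + 1) - v j| ≤ G (j + 2) - G j) :
    weightedTV χ v ≤ ENNReal.ofReal (8 * K) := by
  have hK0 : 0 ≤ K := (abs_nonneg _).trans (hK 0)
  have hs := tsum_monotone_increments_le hG hK
  calc weightedTV χ v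
      ≤ ∑' j, (ENNReal.ofReal (G (j + 1 + 1) - G (j + 1)) + ENNReal.ofReal (G (j + 1) - G j)) := by
        refine ENNReal.tsum_le_tsum fun j => ?_
        by_cases hj : χ j = 0
        · simp [hj]
        · rw [Real.enorm_eq_ofReal_abs,
            ← ENNReal.ofReal_add (sub_nonneg.2 (hG (by linarith))) (sub_nonneg.2 (hG (by linarith)))]
          refine (mul_le_mul_left (hχ j) _).trans ?_
          rw [one_mul]
          refine ENNReal.ofReal_le_ofReal ((h j hj).trans (le_of_eq ?_))
          rw [add_assoc, one_add_one_eq_two]; ring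
    _ ≤ ENNReal.ofReal (4 * K) + ENNReal.ofReal (4 * K) := by
        rw [ENNReal.tsum_add, tsum_shift_succ (fun j => ENNReal.ofReal (G (j + 1) - G j))]
        exact add_le_add hs hs
    _ = _ := by rw [← ENNReal.ofReal_add (by positivity) (by positivity)]; congr 1; ring

theorem VariationMajorant.monotone_grid {u g : ℝ → ℝ} {K : ℝ} (h : VariationMajorant u g K)
    {dx : ℝ} (hdx : 0 < dx) : Monotone (fun j : ℤ => g (j * dx)) := fun i j hij =>
  h.mono (mul_le_mul_of_nonneg_right (by exact_mod_cast hij) hdx.le)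

theorem VariationMajorant.gridTV_cellAverages_le {u g : ℝ → ℝ} {K : ℝ}
    (h : VariationMajorant u g K) {dx : ℝ} (hdx : 0 < dx) :
    gridTV (cellAverages dx u) ≤ ENNReal.ofReal (8 * K) := by
  rw [← weightedTV_one]
  refine weightedTV_le_of_monotone (fun _ => le_rfl) (h.monotone_grid hdx)
    (fun j => by rw [abs_of_nonneg (h.nonneg _)]; exact h.le _) (fun j _ => ?_)
  push_cast
  exact h.abs_cellAverages_succ_sub_le hdx j

/-- A Lipschitz weight that vanishes for `|x| ≤ R` and is `1` for `|x| ≥ 2 R`. -/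
def outerWeight (R dx : ℝ) (j : ℤ) : ℝ≥0∞ := ENNReal.ofReal (min 1 ((|j * dx| - R) / R))

theorem outerWeight_le_one (R dx : ℝ) (j : ℤ) : outerWeight R dx j ≤ 1 := by
  rw [outerWeight, ← ENNReal.ofReal_one]
  exact ENNReal.ofReal_le_ofReal (min_le_left _ _)

theorem outerWeight_eq_one {R dx : ℝ} (hR : 0 < R) {j : ℤ} (hj : 2 * R ≤ |j * dx|) :
    outerWeight R dx j = 1 := by
  rw [outerWeight, min_eq_left, ENNReal.ofReal_one]
  rw [le_div_iff₀ hR]; linarith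

theorem lt_of_outerWeight_ne_zero {R dx : ℝ} (hR : 0 < R) {j : ℤ}
    (hj : outerWeight R dx j ≠ 0) : R < |j * dx| := by
  by_contra! h
  refine hj (ENNReal.ofReal_of_nonpos ((min_le_right _ _).trans ?_))
  exact div_nonpos_of_nonpos_of_nonneg (by linarith) hR.le

theorem outerWeight_le_add {R dx : ℝ} (hR : 0 < R) (hdx : 0 < dx) {i j : ℤ}
    (hij : |(i : ℝ) - j| ≤ 1) :
    outerWeight R dx i ≤ outerWeight R dx j + ENNReal.ofReal (dx / R) := by
  have h1 : |i * dx| ≤ |j * dx| + dx := by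
    have h2 : |i * dx| - |j * dx| ≤ |i * dx - j * dx| := abs_sub_abs_le_abs_sub _ _
    rw [← sub_mul, abs_mul ((i : ℝ) - j), abs_of_pos hdx] at h2
    have := mul_le_mul_of_nonneg_right hij hdx.le
    linarith
  refine le_trans (ENNReal.ofReal_le_ofReal ?_) ENNReal.ofReal_add_le
  have h3 : (|i * dx| - R) / R ≤ (|j * dx| - R) / R + dx / R := by
    rw [← add_div]; exact div_le_div_of_nonneg_right (by linarith) hR.le
  have h4 : 0 ≤ dx / R := by positivity
  rw [← min_add_add_right]
  exact min_le_min (by linarith) h3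

theorem VariationMajorant.exists_outer_weightedTV_le {u g : ℝ → ℝ} {K : ℝ}
    (h : VariationMajorant u g K) {ε : ℝ} (hε : 0 < ε) :
    ∃ R₀ : ℝ, 0 < R₀ ∧ ∀ R, R₀ ≤ R → ∀ dx, 0 < dx → dx ≤ 1 →
      weightedTV (outerWeight R dx) (cellAverages dx u) ≤ ENNReal.ofReal ε := by
  have hbdd : BddAbove (range g) := ⟨K, by rintro _ ⟨x, rfl⟩; exact h.le x⟩
  have hbdd' : BddBelow (range g) := ⟨0, by rintro _ ⟨x, rfl⟩; exact h.nonneg x⟩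
  have ht := tendsto_atTop_ciSup h.mono hbdd
  have hb := tendsto_atBot_ciInf h.mono hbdd'
  have e1 := ht.eventually (lt_mem_nhds (show (⨆ x, g x) - ε / 8 < ⨆ x, g x by linarith))
  have e2 := hb.eventually (gt_mem_nhds (show (⨅ x, g x) < (⨅ x, g x) + ε / 8 by linarith))
  obtain ⟨R₁, hR₁, hR₁'⟩ := (e1.and ((tendsto_neg_atTop_atBot.eventually e2).and
    (eventually_gt_atTop 0))).exists
  obtain ⟨hR₂, hR₁0⟩ := hR₁'
  have hle : g (-R₁) ≤ g R₁ := h.mono (by linarith)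
  have hsup : ∀ x, g x ≤ ⨆ x, g x := fun x => le_ciSup hbdd x
  have hinf : ∀ x, (⨅ x, g x) ≤ g x := fun x => ciInf_le hbdd' x
  let G : ℝ → ℝ := fun x => g x - max (g (-R₁)) (min (g x) (g R₁))
  have hGmono : Monotone G := by
    intro x y hxy
    have := h.mono hxy
    simp only [G]
    rcases le_total (g x) (g R₁) with a | a <;> rcases le_total (g y) (g R₁) with b | b <;>
    rcases le_total (g x) (g (-R₁)) with c | c <;> rcases le_total (g y) (g (-R₁)) with d | d <;>
    simp only [min_eq_left, min_eq_right, max_eq_left, max_eq_right, a, b, c, d, hle] <;> linarith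
  have hGabs : ∀ x, |G x| ≤ ε / 8 := by
    intro x
    have s1 := hsup x
    have s2 := hinf x
    simp only [G]
    rw [_root_.abs_le]
    rcases le_total (g x) (g R₁) with a | a <;>
    rcases le_total (g x) (g (-R₁)) with c | c <;>
    simp only [min_eq_left, min_eq_right, max_eq_left, max_eq_right, a, c, hle] <;>
    constructor <;> linarith
  have hGright : ∀ x, R₁ ≤ x → G x = g x - g R₁ := by
    intro x hx
    simp only [G, min_eq_right (h.mono hx), max_eq_right hle]
  have hGleft : ∀ x, x ≤ -R₁ → G x = g x - g (-R₁) := by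
    intro x hx
    simp only [G, min_eq_left ((h.mono hx).trans hle), max_eq_left (h.mono hx)]
  refine ⟨R₁ + 2, by linarith, fun R hR dx hdx hdx1 => ?_⟩
  have := weightedTV_le_of_monotone (v := cellAverages dx u) (χ := outerWeight R dx)
    (outerWeight_le_one R dx) (G := fun j : ℤ => G (j * dx))
    (fun i j hij => hGmono (mul_le_mul_of_nonneg_right (by exact_mod_cast hij) hdx.le))
    (fun j => hGabs _) (fun j hj => ?_)
  · rwa [show 8 * (ε / 8) = ε by ring] at this
  · have hj := lt_of_outerWeight_ne_zero (by linarith) hj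
    have hc := h.abs_cellAverages_succ_sub_le hdx j
    push_cast
    have e : ((j : ℝ) + 2) * dx = j * dx + 2 * dx := by ring
    rcases lt_abs.1 hj with hj | hj
    · rw [hGright _ (by linarith), hGright _ (by linarith)]
      linarith
    · rw [hGleft _ (by linarith), hGleft _ (by linarith)]
      linarith

theorem floor_div_eq_iff {dx : ℝ} (hdx : 0 < dx) (x : ℝ) (j : ℤ) :
    ⌊x / dx⌋ = j ↔ j * dx ≤ x ∧ x < (j + 1) * dx := by
  rw [Int.floor_eq_iff, le_div_iff₀ hdx, div_lt_iff₀ hdx]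

theorem floor_mul_bounds {dx : ℝ} (hdx : 0 < dx) (x : ℝ) :
    x - dx < ⌊x / dx⌋ * dx ∧ ⌊x / dx⌋ * dx ≤ x := by
  have := (floor_div_eq_iff hdx x _).1 rfl
  exact ⟨by linarith, this.1⟩

theorem measurable_comp_floor_div {β : Type*} [MeasurableSpace β] (a : ℤ → β) (dx : ℝ) :
    Measurable fun x : ℝ => a ⌊x / dx⌋ :=
  (measurable_of_countable a).comp (Int.measurable_floor.comp (measurable_id.div_const dx))

theorem lintegral_comp_floor_div {dx : ℝ} (hdx : 0 < dx) (a : ℤ → ℝ≥0∞) :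
    ∫⁻ x : ℝ, a ⌊x / dx⌋ = ENNReal.ofReal dx * ∑' j, a j := by
  have hm : Measurable fun x : ℝ => ⌊x / dx⌋ :=
    Int.measurable_floor.comp (measurable_id.div_const dx)
  rw [← lintegral_map (f := a) (measurable_of_countable a) hm, lintegral_countable',
    ← ENNReal.tsum_mul_left]
  refine tsum_congr fun j => ?_
  rw [Measure.map_apply hm (measurableSet_singleton j), mul_comm]
  congr 1
  have : (fun x : ℝ => ⌊x / dx⌋) ⁻¹' {j} = Ico (j * dx) ((j + 1) * dx) := by
    ext x; simp [floor_div_eq_iff hdx]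
  rw [this, Real.volume_Ico]
  congr 1
  ring

theorem enorm_sub_le_sum_Ico (v : ℤ → ℝ) {i j : ℤ} (hij : i ≤ j) :
    ‖v j - v i‖ₑ ≤ ∑ k ∈ Finset.Ico i j, ‖v (k + 1) - v k‖ₑ := by
  induction j, hij using Int.leInduction with
  | base => simp
  | succ j hij ih =>
    have : Finset.Ico i (j + 1) = insert j (Finset.Ico i j) := by
      ext k; simp only [Finset.mem_Ico, Finset.mem_insert]; omega
    rw [this, Finset.sum_insert (by simp), ← sub_add_sub_cancel (v (j + 1)) (v j) (v i)]
    exact (enorm_add_le _ _).trans (add_le_add le_rfl ih)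

/-- The `L¹` error of sampling a grid function at points at distance less than `h` to the left. -/
theorem lintegral_sample_le {dx : ℝ} (hdx : 0 < dx) (v : ℤ → ℝ) {h : ℝ} {y : ℝ → ℝ}
    (hy : ∀ x, x - h < y x) (hy' : ∀ x, y x ≤ x) :
    ∫⁻ x : ℝ, ‖v ⌊x / dx⌋ - v ⌊y x / dx⌋‖ₑ ≤ ENNReal.ofReal h * gridTV v := by
  let A : ℤ → Set ℝ := fun k => Ico ((k + 1) * dx) ((k + 1) * dx + h)
  have hA : ∀ k, MeasurableSet (A k) := fun k => measurableSet_Ico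
  calc ∫⁻ x : ℝ, ‖v ⌊x / dx⌋ - v ⌊y x / dx⌋‖ₑ
      ≤ ∫⁻ x : ℝ, ∑' k, (A k).indicator (fun _ => ‖v (k + 1) - v k‖ₑ) x := by
        refine lintegral_mono fun x => ?_
        refine (enorm_sub_le_sum_Ico v (Int.floor_le_floor
          (div_le_div_of_nonneg_right (hy' x) hdx.le))).trans ?_
        refine le_trans (le_of_eq (Finset.sum_congr rfl fun k hk => ?_))
          (ENNReal.sum_le_tsum (Finset.Ico ⌊y x / dx⌋ ⌊x / dx⌋))
        rw [indicator_of_mem]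
        rw [Finset.mem_Ico, Int.floor_le_iff, ← Int.add_one_le_iff, Int.le_floor,
          div_lt_iff₀ hdx, le_div_iff₀ hdx] at hk
        push_cast at hk
        exact ⟨hk.2, by linarith [hy x, hk.1]⟩
    _ = ∑' k, ENNReal.ofReal h * ‖v (k + 1) - v k‖ₑ := by
        rw [lintegral_tsum fun k => ((measurable_const.indicator (hA k))).aemeasurable]
        refine tsum_congr fun k => ?_
        rw [lintegral_indicator_const (hA k), Real.volume_Ico, add_sub_cancel_left, mul_comm]
    _ = _ := by rw [ENNReal.tsum_mul_left, gridTV_eq_tsum_enorm]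

theorem VariationMajorant.lintegral_cellAverages_sub_le {u g : ℝ → ℝ} {K : ℝ}
    (h : VariationMajorant u g K) {dx : ℝ} (hdx : 0 < dx) :
    ∫⁻ x : ℝ, ‖cellAverages dx u ⌊x / dx⌋ - u x‖ₑ ≤ ENNReal.ofReal (dx * (4 * K)) := by
  have hK := h.nonneg_bound
  calc ∫⁻ x : ℝ, ‖cellAverages dx u ⌊x / dx⌋ - u x‖ₑ
      ≤ ∫⁻ x : ℝ, (fun j : ℤ => ENNReal.ofReal (g (((j + 1 : ℤ) : ℝ) * dx) - g (j * dx)))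
          ⌊x / dx⌋ := by
        refine lintegral_mono fun x => ?_
        have hx := (floor_div_eq_iff hdx x _).1 rfl
        rw [Real.enorm_eq_ofReal_abs]
        refine ENNReal.ofReal_le_ofReal ?_
        push_cast
        exact h.abs_cellAverages_sub_le hdx ⟨hx.1, hx.2.le⟩
    _ ≤ ENNReal.ofReal dx * ENNReal.ofReal (4 * K) := by
        refine (lintegral_comp_floor_div hdx
          (fun j : ℤ => ENNReal.ofReal (g (((j + 1 : ℤ) : ℝ) * dx) - g (j * dx)))).le.trans ?_
        exact mul_le_mul_right (tsum_monotone_increments_le (h.monotone_grid hdx)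
          (fun j => by rw [abs_of_nonneg (h.nonneg _)]; exact h.le _)) _
    _ = _ := (ENNReal.ofReal_mul hdx.le).symm

namespace IsIncrementSeq

variable {lam dx dt : ℝ} {v : ℕ → ℤ → ℝ}

theorem lintegral_time_change_le (hv : IsIncrementSeq (2 * lam * dt / dx) v) (hlam : 0 < lam)
    (hdx : 0 < dx) (hdt : 0 < dt) {s t : ℝ} (hs : 0 ≤ s) (hst : s ≤ t) :
    ∫⁻ x : ℝ, ‖v ⌊t / dt⌋₊ ⌊x / dx⌋ - v ⌊s / dt⌋₊ ⌊x / dx⌋‖ₑ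
      ≤ ENNReal.ofReal (2 * lam * (t - s + dt)) * gridTV (v 0) := by
  obtain ⟨n, hn⟩ := Nat.exists_eq_add_of_le
    (Nat.floor_le_floor (div_le_div_of_nonneg_right hst hdt.le))
  have h1 : ((⌊t / dt⌋₊ : ℕ) : ℝ) ≤ t / dt := Nat.floor_le (div_nonneg (hs.trans hst) hdt.le)
  have h2 : s / dt < (⌊s / dt⌋₊ : ℝ) + 1 := Nat.lt_floor_add_one _
  rw [hn] at h1
  push_cast at h1
  rw [le_div_iff₀ hdt] at h1
  rw [div_lt_iff₀ hdt] at h2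
  rw [hn, lintegral_comp_floor_div hdx (fun j => ‖v (⌊s / dt⌋₊ + n) j - v ⌊s / dt⌋₊ j‖ₑ)]
  calc _ ≤ ENNReal.ofReal dx * (n * (ENNReal.ofReal (2 * lam * dt / dx) * gridTV (v 0))) :=
        mul_le_mul_right (hv.tsum_change_le_gridTV _ _) _
    _ = ENNReal.ofReal (dx * (n * (2 * lam * dt / dx))) * gridTV (v 0) := by
        rw [ENNReal.ofReal_mul hdx.le, ENNReal.ofReal_mul (Nat.cast_nonneg n),
          ENNReal.ofReal_natCast]
        ring
    _ ≤ _ := by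
        refine mul_le_mul_left (ENNReal.ofReal_le_ofReal ?_) _
        have : dx * (n * (2 * lam * dt / dx)) = 2 * lam * (n * dt) := by field_simp
        rw [this]
        exact mul_le_mul_of_nonneg_left (by linarith) (by linarith)

/-- The change up to time `T` far away from the origin is controlled by the initial variation
far away from the origin. -/
theorem lintegral_outer_change_le (hv : IsIncrementSeq (2 * lam * dt / dx) v) (hlam : 0 < lam)
    (hdx : 0 < dx) (hdx1 : dx ≤ 1) (hdt : 0 < dt) {R : ℝ} (hR : 0 < R) {t T : ℝ} (ht : 0 ≤ t)
    (htT : t ≤ T) :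
    ∫⁻ x in {x : ℝ | 2 * R + 1 ≤ |x|}, ‖v ⌊t / dt⌋₊ ⌊x / dx⌋ - v 0 ⌊x / dx⌋‖ₑ
      ≤ ENNReal.ofReal (2 * lam * T) * (weightedTV (outerWeight R dx) (v 0)
        + ENNReal.ofReal ((2 * lam * T + 1) / R) * gridTV (v 0)) := by
  set n := ⌊t / dt⌋₊ with hn
  set κ := ENNReal.ofReal (dx / R) with hκ
  set χ := outerWeight R dx with hχ
  have hT : 0 ≤ T := ht.trans htT
  have hnT : (n : ℝ) * dt ≤ T :=
    ((le_div_iff₀ hdt).1 (Nat.floor_le (div_nonneg ht hdt.le))).trans htT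
  have h₁ : ∀ j, χ (j + 1) ≤ χ j + κ := fun j =>
    outerWeight_le_add hR hdx (by push_cast; norm_num)
  have h₂ : ∀ j, χ j ≤ χ (j + 1) + κ := fun j =>
    outerWeight_le_add hR hdx (by push_cast; norm_num)
  set B := weightedTV χ (v 0) + ENNReal.ofReal ((2 * lam * T + 1) / R) * gridTV (v 0) with hB
  have hsum := hv.tsum_change_le (B := B) h₁ 0 n (fun i hi => by
    calc weightedTV χ (v i) + κ * gridTV (v i)
        ≤ (weightedTV χ (v 0) + i * (κ * (ENNReal.ofReal (2 * lam * dt / dx) * gridTV (v 0))))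
          + κ * gridTV (v 0) :=
          add_le_add (hv.weightedTV_le h₁ h₂ i) (mul_le_mul_right (hv.gridTV_le i) _)
      _ = weightedTV χ (v 0)
          + ENNReal.ofReal (i * (dx / R * (2 * lam * dt / dx)) + dx / R) * gridTV (v 0) := by
          rw [ENNReal.ofReal_add (by positivity) (by positivity),
            ENNReal.ofReal_mul (Nat.cast_nonneg i), ENNReal.ofReal_mul (by positivity),
            ENNReal.ofReal_natCast]
          ring
      _ ≤ B := by
          refine add_le_add le_rfl (mul_le_mul_left (ENNReal.ofReal_le_ofReal ?_) _)
          have e : (i : ℝ) * (dx / R * (2 * lam * dt / dx)) = 2 * lam * (i * dt) / R := by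
            field_simp
          rw [e, ← add_div]
          have hi' : (i : ℝ) * dt ≤ T := le_trans (mul_le_mul_of_nonneg_right
            (by exact_mod_cast (by omega : i ≤ n)) hdt.le) hnT
          refine div_le_div_of_nonneg_right ?_ hR.le
          have := mul_le_mul_of_nonneg_left hi' (by positivity : 0 ≤ 2 * lam)
          linarith)
  rw [zero_add] at hsum
  calc _ ≤ ∫⁻ x in {x : ℝ | 2 * R + 1 ≤ |x|}, (fun j : ℤ => χ j * ‖v n j - v 0 j‖ₑ) ⌊x / dx⌋ := by
        refine setLIntegral_mono' (measurableSet_le measurable_const measurable_norm) ?_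
        intro x hx
        have hx : 2 * R + 1 ≤ |x| := hx
        have hb := floor_mul_bounds hdx x
        have hc : |x| ≤ |⌊x / dx⌋ * dx| + dx := by
          have := abs_sub_abs_le_abs_sub x (⌊x / dx⌋ * dx)
          rw [abs_of_nonneg (by linarith : 0 ≤ x - ⌊x / dx⌋ * dx)] at this
          linarith
        simp only []
        rw [hχ, outerWeight_eq_one hR (by linarith), one_mul]
    _ ≤ ENNReal.ofReal dx * (n * (ENNReal.ofReal (2 * lam * dt / dx) * B)) := by
        refine (setLIntegral_le_lintegral _ _).trans ?_
        refine (lintegral_comp_floor_div hdx (fun j => χ j * ‖v n j - v 0 j‖ₑ)).le.trans ?_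
        exact mul_le_mul_right hsum _
    _ = ENNReal.ofReal (dx * (n * (2 * lam * dt / dx))) * B := by
        rw [ENNReal.ofReal_mul hdx.le, ENNReal.ofReal_mul (Nat.cast_nonneg n),
          ENNReal.ofReal_natCast]
        ring
    _ ≤ _ := by
        refine mul_le_mul_left (ENNReal.ofReal_le_ofReal ?_) _
        have : dx * (n * (2 * lam * dt / dx)) = 2 * lam * (n * dt) := by field_simp
        rw [this]
        exact mul_le_mul_of_nonneg_left hnT (by positivity)

end IsIncrementSeq

theorem setLIntegral_prod_Ioo_le {F : ℝ × ℝ → ℝ≥0∞} (hF : Measurable F) {s : Set ℝ} {T : ℝ}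
    {B : ℝ≥0∞} (h : ∀ t ∈ Ioo 0 T, ∫⁻ x in s, F (x, t) ≤ B) :
    ∫⁻ p in s ×ˢ Ioo 0 T, F p ≤ ENNReal.ofReal T * B := by
  rw [Measure.volume_eq_prod, ← Measure.prod_restrict, lintegral_prod_symm _ hF.aemeasurable]
  calc _ ≤ ∫⁻ _ in Ioo (0 : ℝ) T, B := setLIntegral_mono' measurableSet_Ioo h
    _ = _ := by rw [setLIntegral_const, Real.volume_Ioo, sub_zero, mul_comm]

theorem measurable_enorm_sub {α : Type*} [MeasurableSpace α] {u v : α → ℝ} (hu : Measurable u)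
    (hv : Measurable v) : Measurable fun p => ‖u p - v p‖ₑ :=
  (hu.sub hv).enorm

theorem l1Dist_mono {S T : ℝ} (h : S ≤ T) (u w : ℝ × ℝ → ℝ) : l1Dist S u w ≤ l1Dist T u w :=
  lintegral_mono_set (prod_mono le_rfl (Ioo_subset_Ioo_right h))

/-- Uniform estimates for a sequence of approximate solutions with mesh sizes `τ k` in time. -/
structure UniformEstimates (U : ℕ → ℝ × ℝ → ℝ) (τ : ℕ → ℝ) (u₀ : ℝ → ℝ) (M C : ℝ) : Prop where
  measurable : ∀ k, Measurable (U k)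
  measurable_initial : Measurable u₀
  mesh_nonneg : ∀ k, 0 ≤ τ k
  mesh_tendsto : Tendsto τ atTop (𝓝 0)
  nonneg : 0 ≤ C
  abs_le : ∀ k p, |U k p| ≤ M
  space : ∀ k t h (y : ℝ → ℝ), 0 ≤ t → (∀ x, x - h < y x) → (∀ x, y x ≤ x) →
    ∫⁻ x : ℝ, ‖U k (x, t) - U k (y x, t)‖ₑ ≤ ENNReal.ofReal (C * h)
  time : ∀ k s t, 0 ≤ s → s ≤ t →
    ∫⁻ x : ℝ, ‖U k (x, t) - U k (x, s)‖ₑ ≤ ENNReal.ofReal (C * (t - s + τ k))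
  tail : ∀ T ε, 0 < T → 0 < ε → ∃ R : ℝ, ∀ᶠ k in atTop, ∀ t ∈ Ioo 0 T,
    ∫⁻ x in {x : ℝ | R ≤ |x|}, ‖U k (x, t) - u₀ x‖ₑ ≤ ENNReal.ofReal ε

theorem exists_subseq_tendsto_of_countable {ι : Type*} [Countable ι] {a : ℕ → ι → ℝ} {M : ℝ}
    (h : ∀ k i, |a k i| ≤ M) :
    ∃ σ : ℕ → ℕ, StrictMono σ ∧ ∀ i, ∃ l, Tendsto (fun k => a (σ k) i) atTop (𝓝 l) := by
  obtain ⟨b, σ, hσ, hb⟩ := CompactSpace.tendsto_subseq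
    (fun k => fun i => (⟨a k i, abs_le.1 (h k i)⟩ : Icc (-M) M))
  refine ⟨σ, hσ, fun i => ⟨b i, ?_⟩⟩
  exact (continuous_subtype_val.tendsto _).comp ((tendsto_pi_nhds.1 hb) i)

/-- The point of the grid of width `h` below and to the left of `p`. -/
def gridPoint (h : ℝ) (p : ℝ × ℝ) : ℝ × ℝ := (⌊p.1 / h⌋ * h, ⌊p.2 / h⌋ * h)

theorem measurable_gridPoint (h : ℝ) : Measurable (gridPoint h) :=
  (((measurable_comp_floor_div (fun j : ℤ => (j : ℝ) * h) h).comp measurable_fst).prodMk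
    ((measurable_comp_floor_div (fun j : ℤ => (j : ℝ) * h) h).comp measurable_snd))

namespace UniformEstimates

variable {U : ℕ → ℝ × ℝ → ℝ} {τ : ℕ → ℝ} {u₀ : ℝ → ℝ} {M C : ℝ}

theorem comp_strictMono (hU : UniformEstimates U τ u₀ M C) {σ : ℕ → ℕ} (hσ : StrictMono σ) :
    UniformEstimates (fun k => U (σ k)) (fun k => τ (σ k)) u₀ M C where
  measurable k := hU.measurable _
  measurable_initial := hU.measurable_initial
  mesh_nonneg k := hU.mesh_nonneg _
  mesh_tendsto := hU.mesh_tendsto.comp hσ.tendsto_atTop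
  nonneg := hU.nonneg
  abs_le k := hU.abs_le _
  space k := hU.space _
  time k := hU.time _
  tail T ε hT hε := by
    obtain ⟨R, hR⟩ := hU.tail T ε hT hε
    exact ⟨R, hσ.tendsto_atTop.eventually hR⟩

theorem l1Dist_sample_le (hU : UniformEstimates U τ u₀ M C) {T h : ℝ} (hh : 0 < h) (k : ℕ) :
    l1Dist T (U k) (U k ∘ gridPoint h) ≤ ENNReal.ofReal (T * (C * (2 * h + τ k))) := by
  rcases le_or_gt T 0 with hT | hT
  · simp [l1Dist, Ioo_eq_empty hT.not_gt]
  have hC := hU.nonneg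
  have hτ := hU.mesh_nonneg k
  rw [ENNReal.ofReal_mul hT.le]
  refine setLIntegral_prod_Ioo_le (((hU.measurable k).sub
    ((hU.measurable k).comp (measurable_gridPoint h))).enorm) fun t ht => ?_
  rw [setLIntegral_univ]
  have hs := floor_mul_bounds hh t
  have hs0 : 0 ≤ (⌊t / h⌋ : ℝ) * h :=
    mul_nonneg (by exact_mod_cast Int.floor_nonneg.2 (div_nonneg ht.1.le hh.le)) hh.le
  have hm : ∀ s, Measurable fun x : ℝ => U k (x, s) := fun s =>
    (hU.measurable k).comp (measurable_id.prodMk measurable_const)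
  calc ∫⁻ x : ℝ, ‖U k (x, t) - (U k ∘ gridPoint h) (x, t)‖ₑ
      ≤ ∫⁻ x : ℝ, (‖U k (x, t) - U k (x, ⌊t / h⌋ * h)‖ₑ
          + ‖U k (x, ⌊t / h⌋ * h) - U k (⌊x / h⌋ * h, ⌊t / h⌋ * h)‖ₑ) := by
        refine lintegral_mono fun x => ?_
        rw [← sub_add_sub_cancel _ (U k (x, ⌊t / h⌋ * h)) _]
        exact enorm_add_le _ _
    _ ≤ ENNReal.ofReal (C * (t - ⌊t / h⌋ * h + τ k)) + ENNReal.ofReal (C * h) := by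
        rw [lintegral_add_left (measurable_enorm_sub (hm t) (hm _))]
        exact add_le_add (hU.time k _ _ hs0 hs.2) (hU.space k _ h _ hs0
          (fun x => (floor_mul_bounds hh x).1) (fun x => (floor_mul_bounds hh x).2))
    _ ≤ _ := by
        rw [← ENNReal.ofReal_add (mul_nonneg hC (by linarith)) (by positivity), ← mul_add]
        exact ENNReal.ofReal_le_ofReal (mul_le_mul_of_nonneg_left (by linarith) hC)

theorem tendsto_sample_box (hU : UniformEstimates U τ u₀ M C)
    (hlim : ∀ q : ℚ × ℚ, ∃ l, Tendsto (fun k => U k ((q.1 : ℝ), (q.2 : ℝ))) atTop (𝓝 l))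
    (m : ℕ) {s : Set ℝ} (hs : volume s ≠ ∞) (T : ℝ) :
    Tendsto (fun kl : ℕ × ℕ => ∫⁻ p in s ×ˢ Ioo 0 T,
      ‖U kl.1 (gridPoint (1 / (m + 1)) p) - U kl.2 (gridPoint (1 / (m + 1)) p)‖ₑ)
      (atTop ×ˢ atTop) (𝓝 0) := by
  have key := tendsto_lintegral_filter_of_dominated_convergence (l := atTop ×ˢ atTop)
    (μ := volume.restrict (s ×ˢ Ioo 0 T))
    (F := fun (kl : ℕ × ℕ) p => ‖U kl.1 (gridPoint (1 / (m + 1)) p)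
      - U kl.2 (gridPoint (1 / (m + 1)) p)‖ₑ) (f := fun _ => 0)
    (fun _ => ENNReal.ofReal (2 * M)) ?_ ?_ ?_ ?_
  · simpa using key
  · exact Eventually.of_forall fun kl => (((hU.measurable _).comp (measurable_gridPoint _)).sub
      ((hU.measurable _).comp (measurable_gridPoint _))).enorm
  · refine Eventually.of_forall fun kl => Eventually.of_forall fun p => ?_
    rw [Real.enorm_eq_ofReal_abs]
    refine ENNReal.ofReal_le_ofReal ((abs_sub _ _).trans ?_)
    linarith [hU.abs_le kl.1 (gridPoint (1 / (m + 1)) p),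
      hU.abs_le kl.2 (gridPoint (1 / (m + 1)) p)]
  · rw [setLIntegral_const, Measure.volume_eq_prod, Measure.prod_prod, Real.volume_Ioo]
    exact ENNReal.mul_ne_top ENNReal.ofReal_ne_top (ENNReal.mul_ne_top hs ENNReal.ofReal_ne_top)
  · refine Eventually.of_forall fun p => ?_
    obtain ⟨l, hl⟩ := hlim (⌊p.1 / (1 / (m + 1) : ℝ)⌋ * (1 / (m + 1)),
      ⌊p.2 / (1 / (m + 1) : ℝ)⌋ * (1 / (m + 1)))
    push_cast at hl
    have h1 := hl.comp (tendsto_fst (f := (atTop : Filter ℕ)) (g := (atTop : Filter ℕ)))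
    have h2 := hl.comp (tendsto_snd (f := (atTop : Filter ℕ)) (g := (atTop : Filter ℕ)))
    have h3 := (h1.sub h2).enorm
    rw [sub_self, enorm_zero] at h3
    exact h3

theorem cauchy_l1Dist (hU : UniformEstimates U τ u₀ M C)
    (hlim : ∀ q : ℚ × ℚ, ∃ l, Tendsto (fun k => U k ((q.1 : ℝ), (q.2 : ℝ))) atTop (𝓝 l))
    {T : ℝ} (hT : 0 < T) {ε : ℝ} (hε : 0 < ε) :
    ∀ᶠ kl : ℕ × ℕ in atTop ×ˢ atTop, l1Dist T (U kl.1) (U kl.2) ≤ ENNReal.ofReal ε := by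
  have hC := hU.nonneg
  obtain ⟨R, hR⟩ := hU.tail T (ε / (8 * T)) hT (by positivity)
  have htail : ∀ᶠ kl : ℕ × ℕ in atTop ×ˢ atTop,
      ∫⁻ p in {x : ℝ | R ≤ |x|} ×ˢ Ioo 0 T, ‖U kl.1 p - U kl.2 p‖ₑ ≤ ENNReal.ofReal (ε / 4) := by
    filter_upwards [tendsto_fst.eventually hR, tendsto_snd.eventually hR] with kl h1 h2
    refine (setLIntegral_prod_Ioo_le ((hU.measurable _).sub (hU.measurable _)).enorm
      (B := ENNReal.ofReal (ε / (8 * T)) + ENNReal.ofReal (ε / (8 * T))) fun t ht => ?_).trans ?_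
    · have hm : ∀ k, Measurable fun x : ℝ => U k (x, t) := fun k =>
        (hU.measurable k).comp (measurable_id.prodMk measurable_const)
      refine le_trans ?_ (add_le_add (h1 t ht) (h2 t ht))
      rw [← lintegral_add_left (measurable_enorm_sub (hm _) hU.measurable_initial)]
      refine lintegral_mono fun x => ?_
      have e : (U kl.1 - U kl.2) (x, t) = (U kl.1 (x, t) - u₀ x) - (U kl.2 (x, t) - u₀ x) := by
        rw [Pi.sub_apply]; ring
      rw [e]
      exact enorm_sub_le
    · rw [← ENNReal.ofReal_add (by positivity) (by positivity), ← ENNReal.ofReal_mul hT.le]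
      refine ENNReal.ofReal_le_ofReal (le_of_eq ?_)
      field_simp
      ring
  obtain ⟨m, hm⟩ : ∃ m : ℕ, T * (C * (2 * (1 / (m + 1 : ℝ)))) ≤ ε / 8 := by
    have h1 : Tendsto (fun m : ℕ => T * (C * (2 * (1 / (m + 1 : ℝ))))) atTop
        (𝓝 (T * (C * (2 * 0)))) :=
      ((tendsto_one_div_add_atTop_nhds_zero_nat.const_mul 2).const_mul C).const_mul T
    rw [mul_zero, mul_zero, mul_zero] at h1
    exact (h1.eventually (ge_mem_nhds (by positivity : (0 : ℝ) < ε / 8))).exists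
  set h : ℝ := 1 / (m + 1) with hh
  have hh0 : 0 < h := by positivity
  have hsample : ∀ᶠ k in atTop, l1Dist T (U k) (U k ∘ gridPoint h) ≤ ENNReal.ofReal (ε / 4) := by
    have h1 : Tendsto (fun k => T * (C * τ k)) atTop (𝓝 (T * (C * 0))) :=
      (hU.mesh_tendsto.const_mul C).const_mul T
    rw [mul_zero, mul_zero] at h1
    filter_upwards [h1.eventually (ge_mem_nhds (by positivity : (0 : ℝ) < ε / 8))] with k hk
    refine (hU.l1Dist_sample_le hh0 k).trans (ENNReal.ofReal_le_ofReal ?_)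
    have : T * (C * (2 * h + τ k)) = T * (C * (2 * h)) + T * (C * τ k) := by ring
    linarith
  have hvol : volume {x : ℝ | R ≤ |x|}ᶜ ≠ ∞ := by
    refine ne_top_of_le_ne_top (b := volume (Icc (-R) R)) (by simp) (measure_mono fun x hx => ?_)
    have hx : ¬ R ≤ |x| := hx
    exact _root_.abs_le.1 (not_le.1 hx).le
  have hbox := (hU.tendsto_sample_box hlim m hvol T).eventually
    (ge_mem_nhds (ENNReal.ofReal_pos.2 (by positivity : (0 : ℝ) < ε / 4)))
  rw [← hh] at hbox
  filter_upwards [htail, hbox, tendsto_fst.eventually hsample, tendsto_snd.eventually hsample]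
    with kl h1 h2 h3 h4
  have hms : ∀ k, Measurable (U k ∘ gridPoint h) := fun k =>
    (hU.measurable k).comp (measurable_gridPoint h)
  have hbox' : ∫⁻ p in {x : ℝ | R ≤ |x|}ᶜ ×ˢ Ioo 0 T, ‖U kl.1 p - U kl.2 p‖ₑ
      ≤ ENNReal.ofReal (ε / 4) + ENNReal.ofReal (ε / 4) + ENNReal.ofReal (ε / 4) := by
    calc _ ≤ ∫⁻ p in {x : ℝ | R ≤ |x|}ᶜ ×ˢ Ioo 0 T,
            (‖U kl.1 p - U kl.1 (gridPoint h p)‖ₑ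
              + ‖U kl.1 (gridPoint h p) - U kl.2 (gridPoint h p)‖ₑ
              + ‖U kl.2 p - U kl.2 (gridPoint h p)‖ₑ) := by
          refine lintegral_mono fun p => ?_
          rw [enorm_sub_rev (U kl.2 p)]
          have e : U kl.1 p - U kl.2 p = (U kl.1 p - U kl.1 (gridPoint h p))
            + (U kl.1 (gridPoint h p) - U kl.2 (gridPoint h p))
            + (U kl.2 (gridPoint h p) - U kl.2 p) := by ring
          rw [e]
          exact (enorm_add_le _ _).trans (add_le_add (enorm_add_le _ _) le_rfl)
      _ ≤ _ := by
          have a1 := measurable_enorm_sub (hU.measurable kl.1) (hms kl.1)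
          have a2 := measurable_enorm_sub (hms kl.1) (hms kl.2)
          refine (lintegral_add_left (a1.add a2) _).le.trans ?_
          refine (add_le_add (lintegral_add_left a1 _).le le_rfl).trans ?_
          refine add_le_add (add_le_add ?_ h2) ?_
          · exact (lintegral_mono_set (prod_mono (subset_univ _) le_rfl)).trans h3
          · exact (lintegral_mono_set (prod_mono (subset_univ _) le_rfl)).trans h4
  calc l1Dist T (U kl.1) (U kl.2)
      ≤ (∫⁻ p in {x : ℝ | R ≤ |x|} ×ˢ Ioo 0 T, ‖U kl.1 p - U kl.2 p‖ₑ)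
        + ∫⁻ p in {x : ℝ | R ≤ |x|}ᶜ ×ˢ Ioo 0 T, ‖U kl.1 p - U kl.2 p‖ₑ := by
        rw [l1Dist, ← union_compl_self {x : ℝ | R ≤ |x|}, union_prod]
        exact lintegral_union_le _ _ _
    _ ≤ ENNReal.ofReal (ε / 4) + (ENNReal.ofReal (ε / 4) + ENNReal.ofReal (ε / 4)
        + ENNReal.ofReal (ε / 4)) := add_le_add h1 hbox'
    _ = ENNReal.ofReal ε := by
        have : 0 ≤ ε / 4 := by positivity
        rw [← ENNReal.ofReal_add this this, ← ENNReal.ofReal_add (by positivity) this,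
          ← ENNReal.ofReal_add this (by positivity)]
        congr 1
        ring

end UniformEstimates

/-- Completeness of `L¹(ℝ × (0, T))`, simultaneously for all `T`. -/
theorem exists_limit_of_cauchy_l1Dist {U : ℕ → ℝ × ℝ → ℝ} (hm : ∀ k, Measurable (U k))
    (hc : ∀ T : ℝ, 0 < T → ∀ ε : ℝ, 0 < ε →
      ∀ᶠ kl : ℕ × ℕ in atTop ×ˢ atTop, l1Dist T (U kl.1) (U kl.2) ≤ ENNReal.ofReal ε) :
    ∃ (w : ℝ × ℝ → ℝ) (σ : ℕ → ℕ), StrictMono σ ∧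
      AEStronglyMeasurable w (volume.restrict (univ ×ˢ Ioi (0 : ℝ))) ∧
      (∀ᵐ p ∂(volume.restrict ((univ : Set ℝ) ×ˢ Ioi (0 : ℝ))),
        Tendsto (fun k => U (σ k) p) atTop (𝓝 (w p))) ∧
      ∀ T : ℝ, 0 < T → Tendsto (fun k => l1Dist T (U (σ k)) w) atTop (𝓝 0) := by
  have hc' : ∀ i : ℕ, ∀ᶠ k in atTop, ∀ k₁ k₂, k ≤ k₁ → k ≤ k₂ →
      l1Dist (i + 1) (U k₁) (U k₂) ≤ ENNReal.ofReal ((1 / 2) ^ i) := by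
    intro i
    have := hc (i + 1) (by positivity) ((1 / 2) ^ i) (by positivity)
    rw [prod_atTop_atTop_eq, eventually_atTop] at this
    obtain ⟨⟨a, b⟩, hab⟩ := this
    filter_upwards [eventually_ge_atTop (max a b)] with k hk k₁ k₂ h1 h2
    exact hab (k₁, k₂) ⟨(le_max_left a b).trans (hk.trans h1), (le_max_right a b).trans (hk.trans h2)⟩
  obtain ⟨σ, hσ, hσc⟩ := extraction_forall_of_eventually hc'
  have hae : ∀ n : ℕ, ∀ᵐ p ∂(volume.restrict ((univ : Set ℝ) ×ˢ Ioo (0 : ℝ) n)),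
      ∃ l, Tendsto (fun k => U (σ k) p) atTop (𝓝 l) := by
    intro n
    have := Lp.ae_tendsto_of_cauchy_eLpNorm
      (μ := volume.restrict ((univ : Set ℝ) ×ˢ Ioo (0 : ℝ) n)) (p := 1)
      (f := fun k => U (σ (k + n))) (fun k => (hm _).aestronglyMeasurable) le_rfl
      (B := fun i => ENNReal.ofReal (2 * (1 / 2) ^ i)) ?_ ?_
    · filter_upwards [this] with p hp
      obtain ⟨l, hl⟩ := hp
      exact ⟨l, (tendsto_add_atTop_iff_nat n).1 hl⟩
    · rw [← ENNReal.ofReal_tsum_of_nonneg (fun i => by positivity)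
        (summable_geometric_two.mul_left 2)]
      exact ENNReal.ofReal_ne_top
    · intro N a b hNa hNb
      rw [eLpNorm_one_eq_lintegral_enorm]
      calc _ = l1Dist n (U (σ (a + n))) (U (σ (b + n))) := rfl
        _ ≤ l1Dist ((N + n : ℕ) + 1) (U (σ (a + n))) (U (σ (b + n))) :=
          l1Dist_mono (by push_cast; linarith [(Nat.cast_nonneg N : (0 : ℝ) ≤ N)]) _ _
        _ ≤ ENNReal.ofReal ((1 / 2) ^ (N + n)) :=
          hσc _ _ _ (hσ.monotone (by omega)) (hσ.monotone (by omega))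
        _ < _ := by
          refine (ENNReal.ofReal_lt_ofReal_iff (by positivity)).2 ?_
          have h1 : (1 / 2 : ℝ) ^ (N + n) ≤ (1 / 2) ^ N :=
            pow_le_pow_of_le_one (by norm_num) (by norm_num) (by omega)
          have h2 : (0 : ℝ) < (1 / 2) ^ N := by positivity
          linarith
  have hunion : (univ : Set ℝ) ×ˢ Ioi (0 : ℝ) = ⋃ n : ℕ, (univ : Set ℝ) ×ˢ Ioo (0 : ℝ) n := by
    ext p
    simp only [mem_prod, mem_univ, true_and, mem_Ioi, mem_iUnion, mem_Ioo]
    exact ⟨fun h => (exists_nat_gt p.2).imp fun n hn => ⟨h, hn⟩, fun ⟨n, h, _⟩ => h⟩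
  have hae' : ∀ᵐ p ∂(volume.restrict ((univ : Set ℝ) ×ˢ Ioi (0 : ℝ))),
      Tendsto (fun k => U (σ k) p) atTop (𝓝 (limUnder atTop fun k => U (σ k) p)) := by
    rw [hunion, ae_restrict_iUnion_iff]
    intro n
    filter_upwards [hae n] with p hp
    exact tendsto_nhds_limUnder hp
  refine ⟨fun p => limUnder atTop fun k => U (σ k) p, σ, hσ,
    aestronglyMeasurable_of_tendsto_ae atTop (fun k => (hm (σ k)).aestronglyMeasurable) hae',
    hae', fun T hT => ?_⟩
  rw [ENNReal.tendsto_atTop_zero]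
  intro ε hε
  obtain ⟨r, hr, hrε⟩ := ENNReal.lt_iff_exists_nnreal_btwn.1 hε
  have := hc T hT r (by exact_mod_cast hr)
  rw [prod_atTop_atTop_eq, eventually_atTop] at this
  obtain ⟨⟨a, b⟩, hab⟩ := this
  refine ⟨max a b, fun k hk => le_trans ?_ hrε.le⟩
  rw [← ENNReal.ofReal_coe_nnreal]
  have hsub : (univ : Set ℝ) ×ˢ Ioo (0 : ℝ) T ⊆ univ ×ˢ Ioi 0 :=
    prod_mono le_rfl Ioo_subset_Ioi_self
  calc l1Dist T (U (σ k)) (fun p => limUnder atTop fun k => U (σ k) p)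
      = ∫⁻ p in (univ : Set ℝ) ×ˢ Ioo (0 : ℝ) T,
          liminf (fun l => ‖U (σ k) p - U (σ l) p‖ₑ) atTop := by
        refine lintegral_congr_ae ?_
        filter_upwards [ae_restrict_of_ae_restrict_of_subset hsub hae'] with p hp
        exact ((tendsto_const_nhds.sub hp).enorm.liminf_eq).symm
    _ ≤ liminf (fun l => l1Dist T (U (σ k)) (U (σ l))) atTop :=
        lintegral_liminf_le' fun l => (measurable_enorm_sub (hm _) (hm _)).aemeasurable
    _ ≤ ENNReal.ofReal r := by
        refine liminf_le_of_frequently_le' (Eventually.frequently ?_)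
        filter_upwards [eventually_ge_atTop (max a b)] with l hl
        exact hab (σ k, σ l) ⟨(le_max_left a b).trans (hk.trans (hσ.id_le k)),
          (le_max_right a b).trans (hl.trans (hσ.id_le l))⟩

/-- Uniformly bounded approximations with uniform estimates are relatively compact. -/
theorem UniformEstimates.exists_limit {U : ℕ → ℝ × ℝ → ℝ} {τ : ℕ → ℝ} {u₀ : ℝ → ℝ} {M C : ℝ}
    (hU : UniformEstimates U τ u₀ M C) :
    ∃ (w : ℝ × ℝ → ℝ) (σ : ℕ → ℕ), StrictMono σ ∧
      AEStronglyMeasurable w (volume.restrict (univ ×ˢ Ioi (0 : ℝ))) ∧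
      (∀ᵐ p ∂(volume.restrict ((univ : Set ℝ) ×ˢ Ioi (0 : ℝ))),
        Tendsto (fun k => U (σ k) p) atTop (𝓝 (w p))) ∧
      ∀ T : ℝ, 0 < T → Tendsto (fun k => l1Dist T (U (σ k)) w) atTop (𝓝 0) := by
  obtain ⟨σ, hσ, hlim⟩ := exists_subseq_tendsto_of_countable
    (a := fun k (q : ℚ × ℚ) => U k ((q.1 : ℝ), (q.2 : ℝ))) (fun k q => hU.abs_le k _)
  have hUσ := hU.comp_strictMono hσ
  obtain ⟨w, ρ, hρ, h⟩ := exists_limit_of_cauchy_l1Dist hUσ.measurable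
    (fun T hT ε hε => hUσ.cauchy_l1Dist hlim hT hε)
  exact ⟨w, σ ∘ ρ, hσ.comp hρ, h⟩

/-- The standing assumptions on flux, speed and initial datum: `J` is a bounded interval that
contains the values of `u₀` and on which the subcharacteristic condition holds. -/
structure Admissible (f : ℝ → ℝ) (lam : ℝ) (J : Set ℝ) (M : ℝ) (u₀ g : ℝ → ℝ) (K : ℝ) : Prop where
  continuous : Continuous f
  pos : 0 < lam
  ordConnected : J.OrdConnected
  abs_le : ∀ a ∈ J, |a| ≤ M
  lipschitz : ∀ a ∈ J, ∀ b ∈ J, |f b - f a| ≤ lam * |b - a|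
  initial_mem : ∀ x, u₀ x ∈ J
  majorant : VariationMajorant u₀ g K

/-- A sequence of grids whose mesh size tends to zero under the CFL condition. -/
structure Refining (lam : ℝ) (dx dt : ℕ → ℝ) : Prop where
  dx_pos : ∀ k, 0 < dx k
  dt_pos : ∀ k, 0 < dt k
  cfl : ∀ k, lam * dt k ≤ dx k / 2
  tendsto : Tendsto dx atTop (𝓝 0)

theorem Refining.comp {lam : ℝ} {dx dt : ℕ → ℝ} (h : Refining lam dx dt) {σ : ℕ → ℕ}
    (hσ : StrictMono σ) : Refining lam (fun k => dx (σ k)) (fun k => dt (σ k)) :=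
  ⟨fun _ => h.dx_pos _, fun _ => h.dt_pos _, fun _ => h.cfl _, h.tendsto.comp hσ.tendsto_atTop⟩

theorem Refining.tendsto_dt {lam : ℝ} {dx dt : ℕ → ℝ} (h : Refining lam dx dt) (hlam : 0 < lam) :
    Tendsto dt atTop (𝓝 0) := by
  have h1 : Tendsto (fun k => dx k / (2 * lam)) atTop (𝓝 (0 / (2 * lam))) := h.tendsto.div_const _
  rw [zero_div] at h1
  refine squeeze_zero (fun k => (h.dt_pos k).le) (fun k => ?_) h1
  rw [le_div_iff₀ (by positivity)]
  linarith [h.cfl k]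

theorem measurable_comp_floor_prod {β : Type*} [MeasurableSpace β] (a : ℕ → ℤ → β) (dx dt : ℝ) :
    Measurable fun p : ℝ × ℝ => a ⌊p.2 / dt⌋₊ ⌊p.1 / dx⌋ := by
  have h : Measurable fun q : ℕ × ℤ => a q.1 q.2 := measurable_of_countable _
  exact h.comp (((Nat.measurable_floor.comp (measurable_id.div_const dt)).comp
    measurable_snd).prodMk ((Int.measurable_floor.comp (measurable_id.div_const dx)).comp
    measurable_fst))

/-- The piecewise constant function with the value `F_{j-1/2}^n` on the space-time cell `(j, n)`. -/
def approxFlux (f : ℝ → ℝ) (lam dx dt : ℝ) (u₀ : ℝ → ℝ) (p : ℝ × ℝ) : ℝ :=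
  numFlux f f lam lam dx (evolve f f lam lam dx dt (cellAverages dx u₀) ⌊p.2 / dt⌋₊) ⌊p.1 / dx⌋

theorem measurable_approxSolution (f : ℝ → ℝ) (lam dx dt : ℝ) (u₀ : ℝ → ℝ) :
    Measurable (approxSolution f f lam lam dx dt u₀) :=
  measurable_comp_floor_prod (fun n => evolve f f lam lam dx dt (cellAverages dx u₀) n) dx dt

theorem measurable_approxFlux (f : ℝ → ℝ) (lam dx dt : ℝ) (u₀ : ℝ → ℝ) :
    Measurable (approxFlux f lam dx dt u₀) :=
  measurable_comp_floor_prod (fun n => numFlux f f lam lam dx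
    (evolve f f lam lam dx dt (cellAverages dx u₀) n)) dx dt

/-- The scheme, written as a difference equation for functions on space-time. -/
theorem approxSolution_add_dt (f : ℝ → ℝ) {lam : ℝ} (hlam : 0 < lam) {dx dt : ℝ} (hdx : 0 < dx)
    (hdt : 0 < dt) (u₀ : ℝ → ℝ) {p : ℝ × ℝ} (hp : 0 ≤ p.2) :
    approxSolution f f lam lam dx dt u₀ (p + (0, dt))
      = approxSolution f f lam lam dx dt u₀ p
        - dt / dx * (approxFlux f lam dx dt u₀ (p + (dx, 0)) - approxFlux f lam dx dt u₀ p) := by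
  have e1 : ⌊(p.2 + dt) / dt⌋₊ = ⌊p.2 / dt⌋₊ + 1 := by
    rw [add_div, div_self hdt.ne', Nat.floor_add_one (div_nonneg hp hdt.le)]
  have e2 : ⌊(p.1 + dx) / dx⌋ = ⌊p.1 / dx⌋ + 1 := by
    rw [add_div, div_self hdx.ne', Int.floor_add_one]
  simp only [approxSolution, approxFlux, Prod.fst_add, Prod.snd_add, add_zero, e1, e2,
    evolve_succ, step_eq f hlam hdx]

theorem approxSolution_of_lt_dt (f : ℝ → ℝ) (lam : ℝ) {dx dt : ℝ} (hdt : 0 < dt) (u₀ : ℝ → ℝ)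
    {x t : ℝ} (ht : t < dt) :
    approxSolution f f lam lam dx dt u₀ (x, t) = cellAverages dx u₀ ⌊x / dx⌋ := by
  have : ⌊t / dt⌋₊ = 0 := by
    rw [Nat.floor_eq_zero, div_lt_one hdt]; exact ht
  simp only [approxSolution, this]
  rfl

namespace Admissible

variable {f : ℝ → ℝ} {lam : ℝ} {J : Set ℝ} {M : ℝ} {u₀ g : ℝ → ℝ} {K : ℝ} {dx dt : ℝ}

theorem evolve_mem (h : Admissible f lam J M u₀ g K) (hdx : 0 < dx) (hdt : 0 < dt)
    (hcfl : lam * dt ≤ dx / 2) (n : ℕ) (j : ℤ) :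
    evolve f f lam lam dx dt (cellAverages dx u₀) n j ∈ J :=
  CentralScheme.evolve_mem h.pos h.ordConnected h.lipschitz hdx hdt hcfl
    (h.majorant.cellAverages_mem h.ordConnected h.initial_mem hdx) n j

theorem isIncrementSeq (h : Admissible f lam J M u₀ g K) (hdx : 0 < dx) (hdt : 0 < dt)
    (hcfl : lam * dt ≤ dx / 2) :
    IsIncrementSeq (2 * lam * dt / dx) (evolve f f lam lam dx dt (cellAverages dx u₀)) :=
  isIncrementSeq_evolve h.pos h.ordConnected h.lipschitz hdx hdt hcfl
    (h.majorant.cellAverages_mem h.ordConnected h.initial_mem hdx)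

theorem gridTV_evolve_le (h : Admissible f lam J M u₀ g K) (hdx : 0 < dx) (hdt : 0 < dt)
    (hcfl : lam * dt ≤ dx / 2) (n : ℕ) :
    gridTV (evolve f f lam lam dx dt (cellAverages dx u₀) n) ≤ ENNReal.ofReal (8 * K) :=
  ((h.isIncrementSeq hdx hdt hcfl).gridTV_le n).trans (h.majorant.gridTV_cellAverages_le hdx)

theorem abs_approxSolution_le (h : Admissible f lam J M u₀ g K) (hdx : 0 < dx) (hdt : 0 < dt)
    (hcfl : lam * dt ≤ dx / 2) (p : ℝ × ℝ) : |approxSolution f f lam lam dx dt u₀ p| ≤ M :=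
  h.abs_le _ (h.evolve_mem hdx hdt hcfl _ _)

theorem lintegral_approxFlux_sub_le (h : Admissible f lam J M u₀ g K) (hdx : 0 < dx)
    (hdt : 0 < dt) (hcfl : lam * dt ≤ dx / 2) (t : ℝ) :
    ∫⁻ x : ℝ, ‖approxFlux f lam dx dt u₀ (x, t) - f (approxSolution f f lam lam dx dt u₀ (x, t))‖ₑ
      ≤ ENNReal.ofReal (dx * (6 * lam * (3 * (8 * K)))) := by
  have hK := h.majorant.nonneg_bound
  have hlam := h.pos
  set v := evolve f f lam lam dx dt (cellAverages dx u₀) ⌊t / dt⌋₊ with hv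
  have hvJ : ∀ j, v j ∈ J := h.evolve_mem hdx hdt hcfl _
  have hTV : gridTV v ≤ ENNReal.ofReal (8 * K) := h.gridTV_evolve_le hdx hdt hcfl _
  have hpt : ∀ j : ℤ, ‖numFlux f f lam lam dx v j - f (v j)‖ₑ ≤ ENNReal.ofReal (6 * lam)
      * (‖v (j - 1 - 1 + 1) - v (j - 1 - 1)‖ₑ + ‖v (j - 1 + 1) - v (j - 1)‖ₑ
        + ‖v (j + 1) - v j‖ₑ) := by
    intro j
    simp only [Real.enorm_eq_ofReal_abs]
    rw [← ENNReal.ofReal_add (by positivity) (by positivity),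
      ← ENNReal.ofReal_add (by positivity) (by positivity), ← ENNReal.ofReal_mul (by positivity)]
    refine ENNReal.ofReal_le_ofReal (abs_numFlux_sub_le hlam h.lipschitz hdx hvJ (hvJ j) ?_)
    intro i hi
    rw [sub_add_cancel, sub_add_cancel]
    have a1 := abs_nonneg (v (j - 1) - v (j - 1 - 1))
    have a2 := abs_nonneg (v j - v (j - 1))
    have a3 := abs_nonneg (v (j + 1) - v j)
    have hi' : i = j - 1 - 1 ∨ i = j - 1 ∨ i = j ∨ i = j + 1 := by
      rw [Finset.mem_Icc] at hi; omega
    rcases hi' with rfl | rfl | rfl | rfl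
    · have := abs_sub_le (v j) (v (j - 1)) (v (j - 1 - 1))
      rw [abs_sub_comm]; linarith
    · rw [abs_sub_comm]; linarith
    · rw [sub_self, abs_zero]; positivity
    · linarith
  calc _ = ∫⁻ x : ℝ, (fun j => ‖numFlux f f lam lam dx v j - f (v j)‖ₑ) ⌊x / dx⌋ := rfl
    _ = ENNReal.ofReal dx * ∑' j, ‖numFlux f f lam lam dx v j - f (v j)‖ₑ :=
        lintegral_comp_floor_div hdx (fun j => ‖numFlux f f lam lam dx v j - f (v j)‖ₑ)
    _ ≤ ENNReal.ofReal dx * (ENNReal.ofReal (6 * lam) * (gridTV v + gridTV v + gridTV v)) := by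
        refine mul_le_mul_right ((ENNReal.tsum_le_tsum hpt).trans (le_of_eq ?_)) _
        rw [ENNReal.tsum_mul_left, ENNReal.tsum_add, ENNReal.tsum_add,
          tsum_shift_pred (fun j => ‖v (j - 1 + 1) - v (j - 1)‖ₑ),
          tsum_shift_pred (fun j => ‖v (j + 1) - v j‖ₑ), gridTV_eq_tsum_enorm]
    _ ≤ ENNReal.ofReal dx * (ENNReal.ofReal (6 * lam) * (ENNReal.ofReal (8 * K)
          + ENNReal.ofReal (8 * K) + ENNReal.ofReal (8 * K))) := by gcongr
    _ = _ := by
        rw [← ENNReal.ofReal_add (by positivity) (by positivity),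
          ← ENNReal.ofReal_add (by positivity) (by positivity),
          ← ENNReal.ofReal_mul (by positivity), ← ENNReal.ofReal_mul hdx.le]
        congr 1
        ring

theorem uniformEstimates (h : Admissible f lam J M u₀ g K) {dx dt : ℕ → ℝ}
    (hr : Refining lam dx dt) :
    UniformEstimates (fun k => approxSolution f f lam lam (dx k) (dt k) u₀) dt u₀ M
      ((1 + 2 * lam) * (8 * K)) where
  measurable k := measurable_approxSolution f lam (dx k) (dt k) u₀
  measurable_initial := h.majorant.measurable
  mesh_nonneg k := (hr.dt_pos k).le
  mesh_tendsto := hr.tendsto_dt h.pos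
  nonneg := by
    have := h.majorant.nonneg_bound
    have := h.pos
    positivity
  abs_le k := h.abs_approxSolution_le (hr.dx_pos k) (hr.dt_pos k) (hr.cfl k)
  space k t r y _ hy hy' := by
    have hK := h.majorant.nonneg_bound
    have hlam := h.pos
    have hr0 : 0 ≤ r := by linarith [hy 0, hy' 0]
    refine (lintegral_sample_le (hr.dx_pos k) _ hy hy').trans ((mul_le_mul_right
      (h.gridTV_evolve_le (hr.dx_pos k) (hr.dt_pos k) (hr.cfl k) ⌊t / dt k⌋₊) _).trans ?_)
    rw [← ENNReal.ofReal_mul hr0]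
    refine ENNReal.ofReal_le_ofReal ?_
    have : 0 ≤ 2 * lam * (8 * K) * r := by positivity
    linarith
  time k s t hs hst := by
    have hK := h.majorant.nonneg_bound
    have hlam := h.pos
    have hdt := hr.dt_pos k
    refine ((h.isIncrementSeq (hr.dx_pos k) hdt (hr.cfl k)).lintegral_time_change_le hlam
      (hr.dx_pos k) hdt hs hst).trans ((mul_le_mul_right
      (h.gridTV_evolve_le (hr.dx_pos k) hdt (hr.cfl k) 0) _).trans ?_)
    have h0 : 0 ≤ t - s + dt k := by linarith
    rw [← ENNReal.ofReal_mul (by positivity)]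
    refine ENNReal.ofReal_le_ofReal ?_
    have : 0 ≤ 8 * K * (t - s + dt k) := by positivity
    linarith
  tail T ε hT hε := by
    have hK := h.majorant.nonneg_bound
    have hlam := h.pos
    set A := 2 * lam * T with hA
    have hA0 : 0 < A := by positivity
    set δ := ε / (4 * (A + 1)) with hδ
    have hδ0 : 0 < δ := by positivity
    have hAδ : A * δ ≤ ε / 4 := by
      rw [hδ, mul_div_assoc', div_le_div_iff₀ (by positivity) (by positivity)]
      nlinarith
    obtain ⟨R₀, hR₀, hout⟩ := h.majorant.exists_outer_weightedTV_le hδ0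
    set R := max R₀ ((A + 1) * (8 * K) / δ) with hR
    have hR0 : 0 < R := hR₀.trans_le (le_max_left _ _)
    have hRδ : (A + 1) / R * (8 * K) ≤ δ := by
      have h1 : (A + 1) * (8 * K) / δ ≤ R := le_max_right _ _
      rw [div_le_iff₀ hδ0] at h1
      rw [div_mul_eq_mul_div, div_le_iff₀ hR0]
      linarith
    refine ⟨2 * R + 1, ?_⟩
    have h4K : Tendsto (fun k => dx k * (4 * K)) atTop (𝓝 (0 * (4 * K))) :=
      hr.tendsto.mul_const _
    rw [zero_mul] at h4K
    filter_upwards [hr.tendsto.eventually (ge_mem_nhds one_pos),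
      h4K.eventually (ge_mem_nhds (by positivity : (0 : ℝ) < ε / 4))] with k hk1 hk2 t ht
    have hdx := hr.dx_pos k
    have hdt := hr.dt_pos k
    have hseq := h.isIncrementSeq hdx hdt (hr.cfl k)
    calc _ ≤ ∫⁻ x in {x : ℝ | 2 * R + 1 ≤ |x|},
          (‖evolve f f lam lam (dx k) (dt k) (cellAverages (dx k) u₀) ⌊t / dt k⌋₊ ⌊x / dx k⌋
              - cellAverages (dx k) u₀ ⌊x / dx k⌋‖ₑ
            + ‖cellAverages (dx k) u₀ ⌊x / dx k⌋ - u₀ x‖ₑ) := by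
          refine lintegral_mono fun x => ?_
          rw [← sub_add_sub_cancel _ (cellAverages (dx k) u₀ ⌊x / dx k⌋) (u₀ x)]
          exact enorm_add_le _ _
      _ ≤ ENNReal.ofReal A * (ENNReal.ofReal δ + ENNReal.ofReal ((A + 1) / R)
            * ENNReal.ofReal (8 * K)) + ENNReal.ofReal (dx k * (4 * K)) := by
          rw [lintegral_add_left (measurable_enorm_sub (measurable_comp_floor_div _ _)
            (measurable_comp_floor_div _ _))]
          refine add_le_add ((hseq.lintegral_outer_change_le hlam hdx hk1 hdt hR0 ht.1.le
            ht.2.le).trans (mul_le_mul_right (add_le_add (hout R (le_max_left _ _) _ hdx hk1)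
              (mul_le_mul_right (h.gridTV_evolve_le hdx hdt (hr.cfl k) 0) _)) _)) ?_
          exact (setLIntegral_le_lintegral _ _).trans
            (h.majorant.lintegral_cellAverages_sub_le hdx)
      _ ≤ ENNReal.ofReal ε := by
          rw [← ENNReal.ofReal_mul (by positivity),
            ← ENNReal.ofReal_add hδ0.le (by positivity), ← ENNReal.ofReal_mul hA0.le,
            ← ENNReal.ofReal_add (by positivity) (by positivity)]
          refine ENNReal.ofReal_le_ofReal ?_
          have : A * (δ + (A + 1) / R * (8 * K)) ≤ A * (δ + δ) := by gcongr
          linarith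

end Admissible

theorem integral_halfSpace_shift (h : ℝ × ℝ → ℝ) (a b : ℝ) :
    ∫ p in (univ : Set ℝ) ×ˢ Ioi b, h (p - (a, b)) = ∫ p in (univ : Set ℝ) ×ˢ Ioi (0 : ℝ), h p := by
  have h1 := integral_sub_right_eq_self (μ := (volume : Measure (ℝ × ℝ)))
    (indicator ((univ : Set ℝ) ×ˢ Ioi (0 : ℝ)) h) (a, b)
  rw [← integral_indicator (MeasurableSet.univ.prod measurableSet_Ioi),
    ← integral_indicator (MeasurableSet.univ.prod measurableSet_Ioi), ← h1]
  congr 1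
  ext p
  simp [indicator_apply]

/-- Summation by parts for a difference equation in conservation form on the half space. -/
theorem integral_difference_eq {U G φ : ℝ × ℝ → ℝ} (hU : Measurable U) (hG : Measurable G)
    {A B : ℝ} (hA : ∀ p, |U p| ≤ A) (hB : ∀ p, |G p| ≤ B) (hφ : Integrable φ) {dx dt : ℝ}
    (hdx : 0 < dx) (hdt : 0 < dt)
    (heq : ∀ p : ℝ × ℝ, 0 < p.2 → U (p + (0, dt)) = U p - dt / dx * (G (p + (dx, 0)) - G p)) :
    (∫ p in (univ : Set ℝ) ×ˢ Ioi (0 : ℝ), (U p * ((φ p - φ (p - (0, dt))) / dt)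
        + G p * ((φ p - φ (p - (dx, 0))) / dx)))
      + 1 / dt * ∫ p in (univ : Set ℝ) ×ˢ Ioc 0 dt, φ (p - (0, dt)) * U p = 0 := by
  have int : ∀ (b : ℝ × ℝ → ℝ), Measurable b → ∀ c, (∀ p, |b p| ≤ c) → ∀ v,
      Integrable (fun p => φ (p - v) * b p) := fun b hb c hc v =>
    (hφ.comp_sub_right v).mul_bdd hb.aestronglyMeasurable (Eventually.of_forall hc)
  have int0 : ∀ (b : ℝ × ℝ → ℝ), Measurable b → ∀ c, (∀ p, |b p| ≤ c) →
      Integrable (fun p => φ p * b p) := fun b hb c hc =>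
    hφ.mul_bdd hb.aestronglyMeasurable (Eventually.of_forall hc)
  set Z : Set (ℝ × ℝ) := univ ×ˢ Ioi (0 : ℝ) with hZ
  have hZm : MeasurableSet Z := MeasurableSet.univ.prod measurableSet_Ioi
  have hGs : Measurable fun p => G (p + (dx, 0)) := hG.comp (measurable_id.add_const _)
  have i1 := (int0 U hU A hA).integrableOn (s := Z)
  have i2 := (int U hU A hA (0, dt)).integrableOn (s := Z)
  have i3 := (int0 G hG B hB).integrableOn (s := Z)
  have i4 := (int G hG B hB (dx, 0)).integrableOn (s := Z)
  have i5 := (int0 _ hGs B (fun p => hB _)).integrableOn (s := Z)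
  have e1 : ∫ p in (univ : Set ℝ) ×ˢ Ioi dt, φ (p - (0, dt)) * U p
      = ∫ p in Z, φ p * U (p + (0, dt)) := by
    rw [hZ, ← integral_halfSpace_shift _ 0 dt]
    simp only [sub_add_cancel]
  have e2 : ∫ p in Z, φ (p - (dx, 0)) * G p = ∫ p in Z, φ p * G (p + (dx, 0)) := by
    have := integral_halfSpace_shift (fun p => φ p * G (p + (dx, 0))) dx 0
    simp only [sub_add_cancel] at this
    exact this
  have i35 : IntegrableOn (fun p => φ p * G (p + (dx, 0)) - φ p * G p) Z := i5.sub i3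
  have i12 : IntegrableOn (fun p => φ p * U p - φ (p - (0, dt)) * U p) Z := i1.sub i2
  have i34 : IntegrableOn (fun p => φ p * G p - φ (p - (dx, 0)) * G p) Z := i3.sub i4
  have e3 : ∫ p in Z, φ p * U (p + (0, dt))
      = (∫ p in Z, φ p * U p) - dt / dx * ((∫ p in Z, φ p * G (p + (dx, 0)))
          - ∫ p in Z, φ p * G p) := by
    rw [← integral_sub i5 i3, ← integral_const_mul, ← integral_sub i1 (i35.const_mul _)]
    refine setIntegral_congr_fun hZm fun p hp => ?_
    rw [heq p hp.2]
    ring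
  have e4 : ∫ p in Z, φ (p - (0, dt)) * U p
      = (∫ p in (univ : Set ℝ) ×ˢ Ioc 0 dt, φ (p - (0, dt)) * U p)
        + ∫ p in (univ : Set ℝ) ×ˢ Ioi dt, φ (p - (0, dt)) * U p := by
    rw [hZ, ← Ioc_union_Ioi_eq_Ioi hdt.le, prod_union]
    refine setIntegral_union ?_ (MeasurableSet.univ.prod measurableSet_Ioi)
      (int U hU A hA _).integrableOn (int U hU A hA _).integrableOn
    rw [disjoint_left]
    exact fun p hp hp' => absurd hp.2.2 (not_le.2 hp'.2)
  have e5 : ∫ p in Z, (U p * ((φ p - φ (p - (0, dt))) / dt)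
        + G p * ((φ p - φ (p - (dx, 0))) / dx))
      = 1 / dt * ((∫ p in Z, φ p * U p) - ∫ p in Z, φ (p - (0, dt)) * U p)
        + 1 / dx * ((∫ p in Z, φ p * G p) - ∫ p in Z, φ (p - (dx, 0)) * G p) := by
    rw [← integral_sub i1 i2, ← integral_sub i3 i4, ← integral_const_mul, ← integral_const_mul,
      ← integral_add (i12.const_mul _) (i34.const_mul _)]
    refine integral_congr_ae (Eventually.of_forall fun p => ?_)
    ring
  rw [e5, e2, e4, e1, e3]
  field_simp
  ring

/-- Bounds for a compactly supported `C¹` function: Lipschitz constant, supremum and a radius of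
the support. -/
structure TestBounds (φ : ℝ × ℝ → ℝ) (L S R : ℝ) : Prop where
  lipschitz_nonneg : 0 ≤ L
  sup_nonneg : 0 ≤ S
  radius_nonneg : 0 ≤ R
  abs_sub_le : ∀ p q, |φ p - φ q| ≤ L * ‖p - q‖
  abs_le : ∀ p, |φ p| ≤ S
  eq_zero : ∀ p, R < ‖p‖ → φ p = 0

theorem exists_testBounds {φ : ℝ × ℝ → ℝ} (hφ : ContDiff ℝ 1 φ) (hc : HasCompactSupport φ) :
    ∃ L S R, TestBounds φ L S R := by
  obtain ⟨L, hL⟩ := hφ.lipschitzWith_of_hasCompactSupport hc one_ne_zero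
  obtain ⟨S, hS⟩ := hφ.continuous.bounded_above_of_compact_support hc
  obtain ⟨R, hR⟩ := hc.isBounded.subset_closedBall 0
  refine ⟨L, S, max R 0, L.2, (norm_nonneg _).trans (hS 0), le_max_right _ _, fun p q => ?_, hS,
    fun p hp => ?_⟩
  · have := hL.dist_le_mul p q
    rwa [Real.dist_eq, dist_eq_norm] at this
  · by_contra hne
    have := hR (subset_tsupport _ hne)
    rw [mem_closedBall_zero_iff] at this
    exact absurd hp (not_lt.2 (this.trans (le_max_left _ _)))

namespace TestBounds

variable {φ : ℝ × ℝ → ℝ} {L S R : ℝ}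

theorem abs_quotient_le (h : TestBounds φ L S R) {v : ℝ × ℝ} {τ : ℝ} (hτ : 0 < τ) (hτ1 : τ ≤ 1)
    (hv : ‖v‖ = τ) (p : ℝ × ℝ) :
    |(φ p - φ (p - v)) / τ| ≤ (Metric.closedBall (0 : ℝ × ℝ) (R + 1)).indicator (fun _ => L) p := by
  by_cases hp : p ∈ Metric.closedBall (0 : ℝ × ℝ) (R + 1)
  · rw [indicator_of_mem hp, abs_div, abs_of_pos hτ, div_le_iff₀ hτ]
    have := h.abs_sub_le p (p - v)
    rwa [sub_sub_cancel, hv] at this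
  · rw [indicator_of_notMem hp]
    rw [mem_closedBall_zero_iff, not_le] at hp
    have h1 : ‖p‖ - ‖v‖ ≤ ‖p - v‖ := norm_sub_norm_le _ _
    rw [h.eq_zero p (by linarith), h.eq_zero (p - v) (by linarith)]
    simp

theorem norm_time (τ : ℝ) (hτ : 0 < τ) : ‖((0, τ) : ℝ × ℝ)‖ = τ := by
  simp [Prod.norm_def, abs_of_pos hτ, hτ.le]

theorem norm_space (τ : ℝ) (hτ : 0 < τ) : ‖((τ, 0) : ℝ × ℝ)‖ = τ := by
  simp [Prod.norm_def, abs_of_pos hτ, hτ.le]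

end TestBounds

theorem tendsto_quotient {φ : ℝ × ℝ → ℝ} (hφ : ContDiff ℝ 1 φ) {τ : ℕ → ℝ} (hτ : ∀ k, 0 < τ k)
    (hlim : Tendsto τ atTop (𝓝 0)) (v p : ℝ × ℝ) :
    Tendsto (fun k => (φ p - φ (p - τ k • v)) / τ k) atTop (𝓝 (fderiv ℝ φ p v)) := by
  have h1 := ((hφ.differentiable one_ne_zero) p).hasFDerivAt.hasLineDerivAt v
  rw [HasLineDerivAt, hasDerivAt_iff_tendsto_slope_zero] at h1
  have h2 : Tendsto (fun k => -τ k) atTop (𝓝[≠] 0) := by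
    refine tendsto_nhdsWithin_iff.2 ⟨by simpa using hlim.neg, Eventually.of_forall fun k => ?_⟩
    exact neg_ne_zero.2 (hτ k).ne'
  refine (h1.comp h2).congr fun k => ?_
  have := (hτ k).ne'
  simp only [Function.comp_apply, zero_add, zero_smul, add_zero, smul_eq_mul, neg_smul,
    ← sub_eq_add_neg]
  field_simp
  ring

namespace Admissible

variable {f : ℝ → ℝ} {lam : ℝ} {J : Set ℝ} {M : ℝ} {u₀ g : ℝ → ℝ} {K : ℝ}

theorem exists_flux_bound (h : Admissible f lam J M u₀ g K) :
    ∃ B, ∀ a, |a| ≤ M → |f a| ≤ B := by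
  obtain ⟨B, hB⟩ := (isCompact_Icc (a := -M) (b := M)).exists_bound_of_continuousOn
    h.continuous.continuousOn
  exact ⟨B, fun a ha => hB a (_root_.abs_le.1 ha)⟩

theorem abs_approxFlux_le (h : Admissible f lam J M u₀ g K) {dx dt : ℝ} (hdx : 0 < dx)
    (hdt : 0 < dt) (hcfl : lam * dt ≤ dx / 2) {B : ℝ} (hB : ∀ a, |a| ≤ M → |f a| ≤ B)
    (p : ℝ × ℝ) : |approxFlux f lam dx dt u₀ p| ≤ B + 6 * lam * (2 * M) := by
  have hJ := h.evolve_mem hdx hdt hcfl ⌊p.2 / dt⌋₊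
  have h1 := abs_numFlux_sub_le h.pos h.lipschitz hdx hJ (hJ ⌊p.1 / dx⌋) (j := ⌊p.1 / dx⌋)
    (r := 2 * M) (fun i _ => by
      have := abs_sub (evolve f f lam lam dx dt (cellAverages dx u₀) ⌊p.2 / dt⌋₊ i)
        (evolve f f lam lam dx dt (cellAverages dx u₀) ⌊p.2 / dt⌋₊ ⌊p.1 / dx⌋)
      linarith [h.abs_le _ (hJ i), h.abs_le _ (hJ ⌊p.1 / dx⌋)])
  have h2 := hB _ (h.abs_le _ (hJ ⌊p.1 / dx⌋))
  have h3 := abs_sub_abs_le_abs_sub (approxFlux f lam dx dt u₀ p)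
    (f (evolve f f lam lam dx dt (cellAverages dx u₀) ⌊p.2 / dt⌋₊ ⌊p.1 / dx⌋))
  have h4 : |approxFlux f lam dx dt u₀ p
    - f (evolve f f lam lam dx dt (cellAverages dx u₀) ⌊p.2 / dt⌋₊ ⌊p.1 / dx⌋)|
      ≤ 6 * lam * (2 * M) := h1
  linarith

theorem tendsto_flux_error (h : Admissible f lam J M u₀ g K) {dx dt : ℕ → ℝ}
    (hr : Refining lam dx dt) {φ : ℝ × ℝ → ℝ} {L S R : ℝ} (hT : TestBounds φ L S R) :
    Tendsto (fun k => ∫ p in (univ : Set ℝ) ×ˢ Ioi (0 : ℝ),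
      (approxFlux f lam (dx k) (dt k) u₀ p - f (approxSolution f f lam lam (dx k) (dt k) u₀ p))
        * ((φ p - φ (p - (dx k, 0))) / dx k)) atTop (𝓝 0) := by
  have hR := hT.radius_nonneg
  have hL := hT.lipschitz_nonneg
  have hK := h.majorant.nonneg_bound
  have hlam := h.pos
  have hlim : Tendsto (fun k => L * ((R + 2) * (dx k * (6 * lam * (3 * (8 * K)))))) atTop
      (𝓝 (L * ((R + 2) * (0 * (6 * lam * (3 * (8 * K))))))) :=
    ((hr.tendsto.mul_const _).const_mul _).const_mul _
  rw [zero_mul, mul_zero, mul_zero] at hlim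
  refine squeeze_zero_norm' ?_ hlim
  filter_upwards [hr.tendsto.eventually (ge_mem_nhds one_pos)] with k hk
  have hdx := hr.dx_pos k
  refine (norm_integral_le_lintegral_norm _).trans
    (ENNReal.toReal_le_of_le_ofReal (by positivity) ?_)
  set D : ℝ × ℝ → ℝ := fun p => approxFlux f lam (dx k) (dt k) u₀ p
    - f (approxSolution f f lam lam (dx k) (dt k) u₀ p) with hD
  have hDm : Measurable fun p => ‖D p‖ₑ := measurable_enorm_sub (measurable_approxFlux _ _ _ _ _)
    (h.continuous.measurable.comp (measurable_approxSolution _ _ _ _ _))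
  have hZ : MeasurableSet ((univ : Set ℝ) ×ˢ Ioi (0 : ℝ)) :=
    MeasurableSet.univ.prod measurableSet_Ioi
  have hZ' : MeasurableSet ((univ : Set ℝ) ×ˢ Ioo (0 : ℝ) (R + 2)) :=
    MeasurableSet.univ.prod measurableSet_Ioo
  calc _ ≤ ∫⁻ p in (univ : Set ℝ) ×ˢ Ioo (0 : ℝ) (R + 2), ENNReal.ofReal L * ‖D p‖ₑ := by
        rw [← lintegral_indicator hZ, ← lintegral_indicator hZ']
        refine lintegral_mono fun p => ?_
        by_cases hp : p ∈ (univ : Set ℝ) ×ˢ Ioi (0 : ℝ)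
        · have hq := hT.abs_quotient_le hdx hk (TestBounds.norm_space _ hdx) p
          rw [indicator_of_mem hp, norm_mul, ENNReal.ofReal_mul (norm_nonneg _), ofReal_norm,
            mul_comm, Real.norm_eq_abs]
          by_cases hb : p ∈ Metric.closedBall (0 : ℝ × ℝ) (R + 1)
          · rw [indicator_of_mem hb] at hq
            rw [indicator_of_mem]
            · exact mul_le_mul_left (ENNReal.ofReal_le_ofReal hq) _
            · rw [mem_closedBall_zero_iff] at hb
              have := (norm_snd_le p).trans hb
              exact ⟨trivial, hp.2, by linarith [le_abs_self p.2, Real.norm_eq_abs p.2]⟩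
          · rw [indicator_of_notMem hb] at hq
            rw [ENNReal.ofReal_of_nonpos hq, zero_mul]
            exact zero_le
        · rw [indicator_of_notMem hp]
          exact zero_le
    _ ≤ ENNReal.ofReal L * (ENNReal.ofReal (R + 2)
          * ENNReal.ofReal (dx k * (6 * lam * (3 * (8 * K))))) := by
        rw [lintegral_const_mul _ hDm]
        refine mul_le_mul_right (setLIntegral_prod_Ioo_le hDm fun t _ => ?_) _
        rw [setLIntegral_univ]
        exact h.lintegral_approxFlux_sub_le hdx (hr.dt_pos k) (hr.cfl k) t
    _ = _ := by
        rw [← ENNReal.ofReal_mul (by positivity), ← ENNReal.ofReal_mul hL]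

theorem tendsto_initial_layer (h : Admissible f lam J M u₀ g K) {dx dt : ℕ → ℝ}
    (hr : Refining lam dx dt) {φ : ℝ × ℝ → ℝ} (hφ : Continuous φ) {L S R : ℝ}
    (hT : TestBounds φ L S R) :
    Tendsto (fun k => 1 / dt k * ∫ p in (univ : Set ℝ) ×ˢ Ioc 0 (dt k),
      φ (p - (0, dt k)) * approxSolution f f lam lam (dx k) (dt k) u₀ p) atTop
      (𝓝 (∫ x : ℝ, u₀ x * φ (x, 0))) := by
  have hR := hT.radius_nonneg
  have hL := hT.lipschitz_nonneg
  have hS := hT.sup_nonneg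
  have hK := h.majorant.nonneg_bound
  have hlam := h.pos
  have hM : 0 ≤ M := (abs_nonneg _).trans (h.abs_le _ (h.initial_mem 0))
  have hsupp : HasCompactSupport φ := HasCompactSupport.intro
    (isCompact_closedBall (0 : ℝ × ℝ) R) fun p hp => hT.eq_zero p (by
      rwa [mem_closedBall_zero_iff, not_le] at hp)
  have hφi : Integrable φ := hφ.integrable_of_hasCompactSupport hsupp
  have hφ0 : Continuous fun x : ℝ => φ (x, 0) := hφ.comp (by fun_prop)
  have hz : ∀ x t : ℝ, R < |x| → φ (x, t) = 0 := fun x t hx =>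
    hT.eq_zero _ (lt_of_lt_of_le hx (norm_fst_le (x, t)))
  have hφ0i : Integrable fun x : ℝ => u₀ x * φ (x, 0) := by
    have h1 : Integrable fun x : ℝ => φ (x, 0) := hφ0.integrable_of_hasCompactSupport
      (HasCompactSupport.intro (isCompact_Icc (a := -R) (b := R)) fun x hx => hz x 0 (by
        by_contra! hc; exact hx (_root_.abs_le.1 hc)))
    exact h1.bdd_mul h.majorant.measurable.aestronglyMeasurable
      (Eventually.of_forall fun x => h.abs_le _ (h.initial_mem x))
  have hlim : Tendsto (fun k => S * (dx k * (4 * K)) + L * dt k * M * (2 * R)) atTop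
      (𝓝 (S * (0 * (4 * K)) + L * 0 * M * (2 * R))) :=
    ((hr.tendsto.mul_const _).const_mul _).add
      ((((hr.tendsto_dt hlam).const_mul _).mul_const _).mul_const _)
  rw [show S * (0 * (4 * K)) + L * 0 * M * (2 * R) = 0 by ring] at hlim
  rw [tendsto_iff_norm_sub_tendsto_zero]
  refine squeeze_zero (fun _ => norm_nonneg _) (fun k => ?_) hlim
  have hdx := hr.dx_pos k
  have hdt := hr.dt_pos k
  have hUm := measurable_approxSolution f lam (dx k) (dt k) u₀
  have hmeas : (volume : Measure (ℝ × ℝ)).restrict ((univ : Set ℝ) ×ˢ Ioc 0 (dt k))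
      = (volume : Measure ℝ).prod (volume.restrict (Ioo 0 (dt k))) := by
    rw [Measure.volume_eq_prod, ← Measure.prod_restrict, Measure.restrict_univ,
      Measure.restrict_congr_set Ioo_ae_eq_Ioc]
  have hconst : ∫ p in (univ : Set ℝ) ×ˢ Ioc 0 (dt k), u₀ p.1 * φ (p.1, 0)
      = dt k * ∫ x : ℝ, u₀ x * φ (x, 0) := by
    rw [hmeas, integral_fun_fst (fun x : ℝ => u₀ x * φ (x, 0))]
    simp [hdt.le]
  have hi₁ : IntegrableOn (fun p => φ (p - (0, dt k))
      * approxSolution f f lam lam (dx k) (dt k) u₀ p) ((univ : Set ℝ) ×ˢ Ioc 0 (dt k)) :=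
    ((hφi.comp_sub_right (0, dt k)).mul_bdd hUm.aestronglyMeasurable
      (Eventually.of_forall (h.abs_approxSolution_le hdx hdt (hr.cfl k)))).integrableOn
  have hi₂ : IntegrableOn (fun p : ℝ × ℝ => u₀ p.1 * φ (p.1, 0))
      ((univ : Set ℝ) ×ˢ Ioc 0 (dt k)) := by
    rw [IntegrableOn, hmeas]
    exact hφ0i.comp_fst _
  have hdiff : 1 / dt k * (∫ p in (univ : Set ℝ) ×ˢ Ioc 0 (dt k),
      φ (p - (0, dt k)) * approxSolution f f lam lam (dx k) (dt k) u₀ p)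
      - ∫ x : ℝ, u₀ x * φ (x, 0)
      = 1 / dt k * ∫ p in (univ : Set ℝ) ×ˢ Ioc 0 (dt k),
        (φ (p - (0, dt k)) * approxSolution f f lam lam (dx k) (dt k) u₀ p
          - u₀ p.1 * φ (p.1, 0)) := by
    rw [integral_sub hi₁ hi₂, hconst]
    field_simp
  rw [hdiff, norm_mul, Real.norm_of_nonneg (by positivity), one_div, inv_mul_le_iff₀ hdt]
  refine (norm_integral_le_lintegral_norm _).trans
    (ENNReal.toReal_le_of_le_ofReal (by positivity) ?_)
  simp only [ofReal_norm]
  have hFm : Measurable fun p : ℝ × ℝ => ‖φ (p - (0, dt k))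
      * approxSolution f f lam lam (dx k) (dt k) u₀ p - u₀ p.1 * φ (p.1, 0)‖ₑ :=
    measurable_enorm_sub ((hφ.measurable.comp (measurable_id.sub_const _)).mul hUm)
      ((h.majorant.measurable.comp measurable_fst).mul (hφ0.measurable.comp measurable_fst))
  have hset : (volume : Measure (ℝ × ℝ)).restrict ((univ : Set ℝ) ×ˢ Ioc 0 (dt k))
      = volume.restrict ((univ : Set ℝ) ×ˢ Ioo 0 (dt k)) := by
    rw [hmeas, Measure.volume_eq_prod, ← Measure.prod_restrict, Measure.restrict_univ]
  rw [hset, ENNReal.ofReal_mul hdt.le]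
  refine setLIntegral_prod_Ioo_le hFm fun t ht => ?_
  rw [setLIntegral_univ]
  calc _ ≤ ∫⁻ x : ℝ, (ENNReal.ofReal S * ‖cellAverages (dx k) u₀ ⌊x / dx k⌋ - u₀ x‖ₑ
        + (Icc (-R) R).indicator (fun _ => ENNReal.ofReal (L * dt k * M)) x) := by
        refine lintegral_mono fun x => ?_
        simp only [approxSolution_of_lt_dt f lam hdt u₀ ht.2, Prod.mk_sub_mk, sub_zero]
        set c := cellAverages (dx k) u₀ ⌊x / dx k⌋ with hc
        have hcM : |c| ≤ M := h.abs_le _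
          (h.majorant.cellAverages_mem h.ordConnected h.initial_mem hdx _)
        by_cases hx : x ∈ Icc (-R) R
        · rw [indicator_of_mem hx, Real.enorm_eq_ofReal_abs, Real.enorm_eq_ofReal_abs,
            ← ENNReal.ofReal_mul hS, ← ENNReal.ofReal_add (by positivity) (by positivity)]
          refine ENNReal.ofReal_le_ofReal ?_
          have e : φ (x, t - dt k) * c - u₀ x * φ (x, 0)
              = φ (x, 0) * (c - u₀ x) + (φ (x, t - dt k) - φ (x, 0)) * c := by ring
          rw [e]
          refine (abs_add_le _ _).trans ?_
          rw [abs_mul, abs_mul]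
          have h1 : |φ (x, t - dt k) - φ (x, 0)| ≤ L * dt k := by
            refine (hT.abs_sub_le _ _).trans (mul_le_mul_of_nonneg_left ?_ hL)
            simp only [Prod.mk_sub_mk, sub_self, sub_zero, Prod.norm_def, norm_zero]
            rw [Real.norm_eq_abs, abs_of_neg (by linarith [ht.2])]
            exact max_le hdt.le (by linarith [ht.1])
          exact add_le_add (mul_le_mul_of_nonneg_right (hT.abs_le _) (abs_nonneg _))
            (mul_le_mul h1 hcM (abs_nonneg _) (by positivity))
        · have hx' : R < |x| := by
            by_contra! hc; exact hx (_root_.abs_le.1 hc)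
          rw [hz x _ hx', hz x _ hx']
          simp
    _ ≤ ENNReal.ofReal S * ENNReal.ofReal (dx k * (4 * K))
        + ENNReal.ofReal (L * dt k * M) * ENNReal.ofReal (2 * R) := by
        have hm := measurable_enorm_sub (measurable_comp_floor_div
          (cellAverages (dx k) u₀) (dx k)) h.majorant.measurable
        rw [lintegral_add_left (hm.const_mul _), lintegral_const_mul _ hm,
          lintegral_indicator_const measurableSet_Icc, Real.volume_Icc]
        refine add_le_add (mul_le_mul_right (h.majorant.lintegral_cellAverages_sub_le hdx) _)
          (le_of_eq ?_)
        congr 2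
        ring
    _ = _ := by
        rw [← ENNReal.ofReal_mul hS, ← ENNReal.ofReal_mul (by positivity),
          ← ENNReal.ofReal_add (by positivity) (by positivity)]

/-- Limits of the scheme are weak solutions. -/
theorem isWeakSolution_of_tendsto (h : Admissible f lam J M u₀ g K) {dx dt : ℕ → ℝ}
    (hr : Refining lam dx dt) {w : ℝ × ℝ → ℝ}
    (hw : AEStronglyMeasurable w (volume.restrict (univ ×ˢ Ioi (0 : ℝ))))
    (hlim : ∀ᵐ p ∂(volume.restrict ((univ : Set ℝ) ×ˢ Ioi (0 : ℝ))),
      Tendsto (fun k => approxSolution f f lam lam (dx k) (dt k) u₀ p) atTop (𝓝 (w p))) :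
    IsWeakSolution f u₀ w where
  aestronglyMeasurable := hw
  bounded := ⟨M, by
    filter_upwards [hlim] with p hp
    exact le_of_tendsto hp.abs (Eventually.of_forall fun k =>
      h.abs_approxSolution_le (hr.dx_pos k) (hr.dt_pos k) (hr.cfl k) p)⟩
  weak φ hφ hc := by
    obtain ⟨L, S, R, hT⟩ := exists_testBounds hφ hc
    obtain ⟨B, hB⟩ := h.exists_flux_bound
    have hM : 0 ≤ M := (abs_nonneg _).trans (h.abs_le _ (h.initial_mem 0))
    have hB0 : 0 ≤ B := (abs_nonneg _).trans (hB 0 (by simpa using hM))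
    have hφi : Integrable φ := hφ.continuous.integrable_of_hasCompactSupport hc
    have hdt := hr.tendsto_dt h.pos
    set U := fun k => approxSolution f f lam lam (dx k) (dt k) u₀ with hU
    set G := fun k => approxFlux f lam (dx k) (dt k) u₀ with hG
    have hUm : ∀ k, Measurable (U k) := fun k => measurable_approxSolution _ _ _ _ _
    have hGm : ∀ k, Measurable (G k) := fun k => measurable_approxFlux _ _ _ _ _
    have hUM : ∀ k p, |U k p| ≤ M := fun k =>
      h.abs_approxSolution_le (hr.dx_pos k) (hr.dt_pos k) (hr.cfl k)
    have hGB : ∀ k p, |G k p| ≤ B + 6 * lam * (2 * M) := fun k =>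
      h.abs_approxFlux_le (hr.dx_pos k) (hr.dt_pos k) (hr.cfl k) hB
    have hfm : ∀ k, Measurable fun p => f (U k p) := fun k => h.continuous.measurable.comp (hUm k)
    let Qt := fun k p => (φ p - φ (p - (0, dt k))) / dt k
    let Qx := fun k p => (φ p - φ (p - (dx k, 0))) / dx k
    have hQt : ∀ k, Continuous (Qt k) := fun k =>
      (hφ.continuous.sub (hφ.continuous.comp (continuous_id.sub continuous_const))).div_const _
    have hQx : ∀ k, Continuous (Qx k) := fun k =>
      (hφ.continuous.sub (hφ.continuous.comp (continuous_id.sub continuous_const))).div_const _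
    have hQti : ∀ k, Integrable (Qt k) := fun k => (hφi.sub (hφi.comp_sub_right _)).div_const _
    have hQxi : ∀ k, Integrable (Qx k) := fun k => (hφi.sub (hφi.comp_sub_right _)).div_const _
    set Z : Set (ℝ × ℝ) := univ ×ˢ Ioi (0 : ℝ) with hZ
    have hmain : Tendsto (fun k => ∫ p in Z, (U k p * Qt k p + f (U k p) * Qx k p)) atTop
        (𝓝 (∫ p in Z, (w p * fderiv ℝ φ p (0, 1) + f (w p) * fderiv ℝ φ p (1, 0)))) := by
      have hshift : ∀ᶠ k in atTop, dx k ≤ 1 ∧ dt k ≤ 1 :=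
        (hr.tendsto.eventually (ge_mem_nhds one_pos)).and (hdt.eventually (ge_mem_nhds one_pos))
      refine tendsto_integral_filter_of_dominated_convergence
        (fun p => (Metric.closedBall (0 : ℝ × ℝ) (R + 1)).indicator (fun _ => M * L + B * L) p)
        ?_ ?_ ?_ ?_
      · exact Eventually.of_forall fun k => (((hUm k).mul (hQt k).measurable).add
          ((hfm k).mul (hQx k).measurable)).aestronglyMeasurable
      · filter_upwards [hshift] with k hk
        refine Eventually.of_forall fun p => ?_
        have h1 := hT.abs_quotient_le (hr.dt_pos k) hk.2 (TestBounds.norm_time _ (hr.dt_pos k)) p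
        have h2 := hT.abs_quotient_le (hr.dx_pos k) hk.1 (TestBounds.norm_space _ (hr.dx_pos k)) p
        have h3 : |U k p * Qt k p + f (U k p) * Qx k p|
            ≤ M * |Qt k p| + B * |Qx k p| := by
          refine (abs_add_le _ _).trans ?_
          rw [abs_mul, abs_mul]
          exact add_le_add (mul_le_mul_of_nonneg_right (hUM k p) (abs_nonneg _))
            (mul_le_mul_of_nonneg_right (hB _ (hUM k p)) (abs_nonneg _))
        refine h3.trans ((add_le_add (mul_le_mul_of_nonneg_left h1 hM)
          (mul_le_mul_of_nonneg_left h2 hB0)).trans (le_of_eq ?_))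
        by_cases hp : p ∈ Metric.closedBall (0 : ℝ × ℝ) (R + 1)
        · simp only [indicator_of_mem hp]
        · simp only [indicator_of_notMem hp, mul_zero, add_zero]
      · refine (IntegrableOn.integrable_indicator ?_
          Metric.isClosed_closedBall.measurableSet).integrableOn
        exact integrableOn_const measure_closedBall_lt_top.ne
      · filter_upwards [hlim] with p hp
        have h1 := tendsto_quotient hφ hr.dt_pos hdt (0, 1) p
        have h2 := tendsto_quotient hφ hr.dx_pos hr.tendsto (1, 0) p
        simp only [Prod.smul_mk, smul_eq_mul, mul_zero, mul_one] at h1 h2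
        exact (hp.mul h1).add (((h.continuous.tendsto _).comp hp).mul h2)
    have herr := h.tendsto_flux_error hr hT
    have hbd := h.tendsto_initial_layer hr hφ.continuous hT
    have hsum := (hmain.add herr).add hbd
    rw [add_zero] at hsum
    refine tendsto_nhds_unique hsum (tendsto_const_nhds.congr fun k => ?_)
    have hid := integral_difference_eq (hUm k) (hGm k) (hUM k) (hGB k) hφi (hr.dx_pos k)
      (hr.dt_pos k) (fun p hp => approxSolution_add_dt f h.pos (hr.dx_pos k) (hr.dt_pos k) u₀ hp.le)
    refine hid.symm.trans ?_
    congr 1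
    have j1 : IntegrableOn (fun p => U k p * Qt k p) Z :=
      ((hQti k).bdd_mul (hUm k).aestronglyMeasurable
        (Eventually.of_forall (hUM k))).integrableOn
    have j2 : IntegrableOn (fun p => f (U k p) * Qx k p) Z :=
      ((hQxi k).bdd_mul (hfm k).aestronglyMeasurable
        (Eventually.of_forall fun p => hB _ (hUM k p))).integrableOn
    have j3 : IntegrableOn (fun p => G k p * Qx k p) Z :=
      ((hQxi k).bdd_mul (hGm k).aestronglyMeasurable
        (Eventually.of_forall (hGB k))).integrableOn
    have j4 : IntegrableOn (fun p => (G k p - f (U k p)) * Qx k p) Z := by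
      refine (j3.sub j2).congr (Eventually.of_forall fun p => ?_)
      simp only [Pi.sub_apply]
      ring
    have j5 : IntegrableOn (fun p => U k p * Qt k p + f (U k p) * Qx k p) Z := j1.add j2
    refine Eq.trans ?_ (integral_add j5 j4)
    refine integral_congr_ae (Eventually.of_forall fun p => ?_)
    simp only [Qt, Qx]
    ring

end Admissible

theorem exists_admissible {f : ℝ → ℝ} (hf : ContDiff ℝ 1 f) {lam : ℝ} (hlam : 0 < lam) {I : Set ℝ}
    (hI : I.OrdConnected) (hsub : ∀ u ∈ I, -lam ≤ deriv f u ∧ deriv f u ≤ lam) {u₀ : ℝ → ℝ}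
    (hu : BoundedVariationOn u₀ univ) (huI : ∀ x, u₀ x ∈ I) :
    ∃ J M g K, Admissible f lam J M u₀ g K := by
  obtain ⟨g, K, hg⟩ := exists_variationMajorant hu
  exact ⟨I ∩ Icc (-(|u₀ 0| + K)) (|u₀ 0| + K), |u₀ 0| + K, g, K,
    { continuous := hf.continuous
      pos := hlam
      ordConnected := hI.inter ordConnected_Icc
      abs_le := fun a ha => abs_le.2 ha.2
      lipschitz := fun a ha b hb => abs_flux_sub_le hf hI hsub ha.1 hb.1
      initial_mem := fun x => ⟨huI x, abs_le.1 (hg.abs_le x)⟩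
      majorant := hg }⟩

theorem Admissible.exists_subseq_tendsto {f : ℝ → ℝ} {lam : ℝ} {J : Set ℝ} {M : ℝ} {u₀ g : ℝ → ℝ}
    {K : ℝ} (h : Admissible f lam J M u₀ g K) {dx dt : ℕ → ℝ} (hr : Refining lam dx dt) :
    ∃ (w : ℝ × ℝ → ℝ) (σ : ℕ → ℕ), IsWeakSolution f u₀ w ∧ StrictMono σ ∧
      ∀ T : ℝ, 0 < T → Tendsto (fun k => l1Dist T
        (approxSolution f f lam lam (dx (σ k)) (dt (σ k)) u₀) w) atTop (𝓝 0) := by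
  obtain ⟨w, σ, hσ, hw, hae, hT⟩ := (h.uniformEstimates hr).exists_limit
  exact ⟨w, σ, h.isWeakSolution_of_tendsto (hr.comp hσ) hw hae, hσ, hT⟩

theorem l1Dist_congr_right {T : ℝ} (u : ℝ × ℝ → ℝ) {w w' : ℝ × ℝ → ℝ}
    (h : w' =ᵐ[volume.restrict ((univ : Set ℝ) ×ˢ Ioi (0 : ℝ))] w) :
    l1Dist T u w' = l1Dist T u w := by
  refine lintegral_congr_ae ?_
  filter_upwards [ae_restrict_of_ae_restrict_of_subset
    (prod_mono le_rfl Ioo_subset_Ioi_self) h] with p hp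
  rw [hp]

end CentralScheme

end

theorem mainTheorem2 (f : ℝ → ℝ) (hf : ContDiff ℝ 1 f) (lam : ℝ) (hlam : 0 < lam)
    (I : Set ℝ) (hI : I.OrdConnected)
    (hsub : ∀ u ∈ I, -lam ≤ deriv f u ∧ deriv f u ≤ lam) :
    -- consistency: conservative form with a numerical flux consistent with `f`
    ((∀ dx dt : ℝ, 0 < dx → 0 < dt → ∀ (u : ℤ → ℝ) (j : ℤ),
        CentralScheme.step f f lam lam dx dt u j
          = u j - dt / dx * (CentralScheme.numFlux f f lam lam dx u (j + 1)
              - CentralScheme.numFlux f f lam lam dx u j)) ∧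
      (∀ dx : ℝ, 0 < dx → ∀ (c : ℝ) (j : ℤ),
        CentralScheme.numFlux f f lam lam dx (fun _ => c) j = f c) ∧
      (∃ L : ℝ, ∀ dx : ℝ, 0 < dx → ∀ u : ℤ → ℝ, (∀ i, u i ∈ I) → ∀ c ∈ I, ∀ (j : ℤ) (r : ℝ),
        (∀ i ∈ Finset.Icc (j - 2) (j + 1), |u i - c| ≤ r) →
          |CentralScheme.numFlux f f lam lam dx u j - f c| ≤ L * r)) ∧
    -- total variation diminishing
    (∀ dx dt : ℝ, 0 < dx → 0 < dt → lam * dt ≤ dx / 2 →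
      ∀ u : ℤ → ℝ, (∀ j, u j ∈ I) → ∀ n : ℕ,
        CentralScheme.gridTV (CentralScheme.evolve f f lam lam dx dt u (n + 1))
          ≤ CentralScheme.gridTV (CentralScheme.evolve f f lam lam dx dt u n)) ∧
    -- convergence to weak solutions
    (∀ u₀ : ℝ → ℝ, BoundedVariationOn u₀ univ → (∀ x, u₀ x ∈ I) →
      -- the distance to the set of weak solutions tends to zero
      (∀ T : ℝ, 0 < T → ∀ η : ℝ≥0∞, 0 < η → ∃ δ : ℝ, 0 < δ ∧
        ∀ dx dt : ℝ, 0 < dx → dx < δ → 0 < dt → lam * dt ≤ dx / 2 →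
          ∃ w : ℝ × ℝ → ℝ, CentralScheme.IsWeakSolution f u₀ w ∧
            CentralScheme.l1Dist T
              (CentralScheme.approxSolution f f lam lam dx dt u₀) w < η) ∧
      -- every sequence of refined grids has a subsequence that converges to a weak solution
      (∀ dx dt : ℕ → ℝ, (∀ k, 0 < dx k ∧ 0 < dt k ∧ lam * dt k ≤ dx k / 2) →
        Tendsto dx atTop (𝓝 0) →
        ∃ (w : ℝ × ℝ → ℝ) (σ : ℕ → ℕ), CentralScheme.IsWeakSolution f u₀ w ∧ StrictMono σ ∧
          ∀ T : ℝ, 0 < T → Tendsto (fun k => CentralScheme.l1Dist T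
            (CentralScheme.approxSolution f f lam lam (dx (σ k)) (dt (σ k)) u₀) w)
            atTop (𝓝 0)) ∧
      -- if the weak solution is unique, the whole sequence converges to it
      (∀ w : ℝ × ℝ → ℝ, CentralScheme.IsWeakSolution f u₀ w →
        (∀ w' : ℝ × ℝ → ℝ, CentralScheme.IsWeakSolution f u₀ w' →
          w' =ᵐ[volume.restrict ((univ : Set ℝ) ×ˢ Ioi (0 : ℝ))] w) →
        ∀ dx dt : ℕ → ℝ, (∀ k, 0 < dx k ∧ 0 < dt k ∧ lam * dt k ≤ dx k / 2) →
          Tendsto dx atTop (𝓝 0) →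
          ∀ T : ℝ, 0 < T → Tendsto (fun k => CentralScheme.l1Dist T
            (CentralScheme.approxSolution f f lam lam (dx k) (dt k) u₀) w)
            atTop (𝓝 0))) := by
  have hlip : ∀ a ∈ I, ∀ b ∈ I, |f b - f a| ≤ lam * |b - a| := fun a ha b hb =>
    CentralScheme.abs_flux_sub_le hf hI hsub ha hb
  refine ⟨⟨fun dx dt hdx _ u j => CentralScheme.step_eq f hlam hdx dt u j,
    fun dx _ c j => CentralScheme.numFlux_const f hlam dx c j,
    6 * lam, fun dx hdx u hu c hc j r hr =>
      CentralScheme.abs_numFlux_sub_le hlam hlip hdx hu hc hr⟩, ?_, ?_⟩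
  · intro dx dt hdx hdt hcfl u hu n
    obtain ⟨p, q, hpq⟩ := CentralScheme.isIncrementSeq_evolve hlam hI hlip hdx hdt hcfl hu n
    exact hpq.gridTV_le
  · intro u₀ hu₀ hu₀I
    obtain ⟨J, M, g, K, h⟩ := CentralScheme.exists_admissible hf hlam hI hsub hu₀ hu₀I
    refine ⟨?_, ?_, ?_⟩
    · intro T hT η hη
      by_contra! hcon
      choose dx dt hdx hdxk hdt hcfl hfar using fun k : ℕ =>
        hcon (1 / ((k : ℝ) + 1)) (by positivity)
      obtain ⟨w, σ, hw, _, hlim⟩ := h.exists_subseq_tendsto (dx := dx) (dt := dt)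
        ⟨hdx, hdt, hcfl, squeeze_zero (fun k => (hdx k).le) (fun k => (hdxk k).le)
          tendsto_one_div_add_atTop_nhds_zero_nat⟩
      obtain ⟨k, hk⟩ := ((hlim T hT).eventually (gt_mem_nhds hη)).exists
      exact absurd hk (not_lt.2 (hfar (σ k) w hw))
    · intro dx dt hgrid hdx
      exact h.exists_subseq_tendsto ⟨fun k => (hgrid k).1, fun k => (hgrid k).2.1,
        fun k => (hgrid k).2.2, hdx⟩
    · intro w hw huniq dx dt hgrid hdx T hT
      refine tendsto_of_subseq_tendsto fun ns hns => ?_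
      obtain ⟨w', σ, hw', _, hlim⟩ := h.exists_subseq_tendsto
        (dx := fun k => dx (ns k)) (dt := fun k => dt (ns k))
        ⟨fun k => (hgrid _).1, fun k => (hgrid _).2.1, fun k => (hgrid _).2.2, hdx.comp hns⟩
      refine ⟨σ, ?_⟩
      have := hlim T hT
      simpa only [CentralScheme.l1Dist_congr_right _ (huniq w' hw')] using this
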